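/- Fix a finite set $C\subseteq\mathbb N$ and let $Col=C\uplus\{\epsilon\}$, where the neutral colour $\epsilon$ is smaller than every element of $C$. Let $\mathbf{FinScottL}$ be the category whose objects are the finite preordered sets and whose morphisms $A\to B$ are the relations $R\subseteq A\times B$ such that $(a,b)\in R$, $a\le a'$ and $b'\le b$ imply $(a',b')\in R$, with relational composition and identities $\{(a',a)\mid a\le a'\}$. Let $A\otimes B$ be the product preorder, $A\,\&\,B$ the disjoint union (the categorical product), and $A\multimap B=A^{op}\times B$. Let $\square A=Col\times A$, with $(i,a)\le(j,a')$ iff $i=j$ and $a\le a'$, be the colouring comonad, with counit $\{((\epsilon,a),a')\mid a'\le a\}$ and comultiplication $\{((\max(c_1,c_2),a),(c_1,(c_2,a')))\mid a'\le a\}$. Let $!A$ be the comonad of finite subsets of $A$, with $u\le v$ iff every element of $u$ is below some element of $v$; its action on morphisms is $!R=\{(u,v)\mid\forall b\in v\,\exists a\in u,\ (a,b)\in R\}$, its counit is $\{(u,a')\mid\exists a\in u,\ a'\le a\}$ and its comultiplication is $\{(u,U)\mid\forall v\in U,\ v\le u\}$. Write $E={!}\circ\square$ for the composite comonad induced by the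 distributive law ${!}\square A\to\square{!}A$ that relates $u$ to $(c,v)$ iff every $a\in v$ is below some $a'$ with $(c,a')\in u$. Explicitly, $\mathrm{der}:EA\to A$ relates $u$ to $a$ iff $a\le a'$ for some $(\epsilon,a')\in u$, and $\mathrm{dig}:EA\to EEA$ relates $u$ to $U$ iff for all $(c,v)\in U$ and $(d,a)\in v$ there is $(\max(c,d),a')\in u$ with $a\le a'$. For $g:EX\to B$ put $g^\dagger=E(g)\circ\mathrm{dig}:EX\to EB$; let $m:EX\otimes EA\cong E(X\,\&\,A)$ be the Seely isomorphism given by disjoint union, let $\kappa_X=m^{-1}\circ E(\langle \mathrm{id},\mathrm{id}\rangle):EX\to EX\otimes EX$ be contraction, and for $g:EX\otimes EA\to B$ put $g^\dagger=(g\circ m^{-1})^\dagger\circ m:EX\otimes EA\to EB$. Let $R:EX\otimes EA\to A$ and $a\in A$. A semantic run-tree of $R$ producing $a$ is a finitely branching, possibly infinite tree whose nodes are labelled in $X\uplus A$ and coloured in $Col$, whose root has label $a$ and colour $\epsilon$, whose inner nodes have labels in $A$, and such that for every node with label $b\in A$, if $u$ and $v$ are the sets of pairs (colour, label) of its children with label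 in $X$ and in $A$ respectively (both empty when the node is a leaf), then $((u,v),b)\in R$. It is winning if on every infinite branch some element of $C$ occurs infinitely often and the greatest such element is even. Its set of leaves consists of the pairs $(c,x)$ where $x\in X$ is the label of a leaf and $c$ is the maximal colour on the path from this leaf to the root. Define $\mathbf Y_{X,A}(R)$ as the set of pairs $(u,a)$ such that some winning semantic run-tree of $R$ producing $a$ has $u$ as its set of leaves; this is a morphism $EX\to A$. **Proposition.** (1) The operator $\mathbf Y$ is a Conway operator over $\mathbf{FinScottL}$, that is, for all objects $X,Z,A,B$: - (naturality) $\mathbf Y(f\circ(g^\dagger\otimes\mathrm{id}))=\mathbf Y(f)\circ g^\dagger$ for $g:EX\to Z$ and $f:EZ\otimes EA\to A$; - (fixpoint) $\mathbf Y(f)=f\circ(\mathrm{id}\otimes\mathbf Y(f)^\dagger)\circ\kappa_X$ for $f:EX\otimes EA\to A$; - (dinaturality) $\mathbf Y(f\star g)=f\circ(\mathrm{id}\otimes\mathbf Y(g\star f)^\dagger)\circ\kappa_X$ for $f:EX\otimes EB\to A$ and $g:EX\otimes EA\to B$, where $f\star g=f\circ(\mathrm{id}\otimes g^\dagger)\circ(\kappa_X\otimes\mathrm{id})$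 up to associativity, and likewise for $g\star f$; - (diagonal) $\mathbf Y_{X,A}\bigl(\mathbf Y_{X\&A,A}(f\circ(m^{-1}\otimes\mathrm{id}))\circ m\bigr)=\mathbf Y_{X,A}(f\circ(\mathrm{id}\otimes\kappa_A))$, up to associativity, for $f:EX\otimes EA\otimes EA\to A$. (2) On the Kleisli category $\mathbf{FinScottL}_{E}$ of the comonad $E$, which is cartesian closed with products $A\,\&\,B$, terminal object the empty preorder and exponentials $EA\multimap B$, the operator $f\mapsto\mathbf Y(f\circ m)$ is a Conway operator in the usual sense for cartesian categories (naturality in the parameter, and the parametrised fixpoint, dinaturality and diagonal identities). (3) Consequently $\mathbf{FinScottL}_{E}$ is a model of the $\lambda Y$-calculus: for every interpretation of the ground type by an object and of any family of simply-typed constants by global elements of the interpretations of their types, the standard interpretation of simply-typed $\lambda Y$-terms (with $Y_\sigma:(\sigma\to\sigma)\to\sigma$ interpreted by means of $\mathbf Y$) identifies any two terms which are equal in the congruence generated by $\beta$, $\eta$ and $Y_\sigma M=M(Y_\sigma M)$. -/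

import Mathlib

open CategoryTheory MonoidalCategory

universe u v w

/-! ### The category of finite preorders and downward-closed relations -/

/-- An object of `FinScottL`: a finite set with a preorder. -/
structure FinScottL : Type (u + 1) where
  carrier : Type u
  [preorder : Preorder carrier]
  [finite : Finite carrier]

namespace FinScottL

instance : CoeSort FinScottL.{u} (Type u) := ⟨carrier⟩

attribute [instance] preorder finite

/-- A morphism `A ⟶ B`: a relation which is downward closed in `Aᵒᵖ × B`. -/
@[ext]
structure Hom (A B : FinScottL.{u}) where
  rel : A → B → Prop
  down : ∀ {a a' : A} {b b' : B}, rel a b → a ≤ a' → b' ≤ b → rel a' b'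

/-- Identities are `{(a', a) | a ≤ a'}`, and composition is relational composition. -/
instance : Category FinScottL.{u} where
  Hom := Hom
  id _ := ⟨fun a' a => a ≤ a', fun h h₁ h₂ => h₂.trans (h.trans h₁)⟩
  comp R S := ⟨fun a c => ∃ b, R.rel a b ∧ S.rel b c,
    fun ⟨b, h, h'⟩ h₁ h₂ => ⟨b, R.down h h₁ le_rfl, S.down h' le_rfl h₂⟩⟩
  id_comp R := Hom.ext (funext fun a => funext fun _ => propext
    ⟨fun ⟨_, h, h'⟩ => R.down h' h le_rfl, fun h => ⟨a, le_rfl, h⟩⟩)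
  comp_id R := Hom.ext (funext fun _ => funext fun b => propext
    ⟨fun ⟨_, h, h'⟩ => R.down h le_rfl h', fun h => ⟨b, h, le_rfl⟩⟩)
  assoc _ _ _ := Hom.ext (funext fun _ => funext fun _ => propext
    ⟨fun ⟨c, ⟨d, h₁, h₂⟩, h₃⟩ => ⟨d, h₁, c, h₂, h₃⟩,
      fun ⟨d, h₁, c, h₂, h₃⟩ => ⟨c, ⟨d, h₁, h₂⟩, h₃⟩⟩)

theorem hom_ext {A B : FinScottL.{u}} {R S : A ⟶ B} (h : ∀ a b, R.rel a b ↔ S.rel a b) : R = S :=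
  Hom.ext (funext fun a => funext fun b => propext (h a b))

theorem down {A B : FinScottL.{u}} (R : A ⟶ B) {a a' : A} {b b' : B} (h : R.rel a b)
    (ha : a ≤ a') (hb : b' ≤ b) : R.rel a' b' := Hom.down R h ha hb

@[simp] theorem id_rel {A : FinScottL.{u}} (a b : A) : Hom.rel (𝟙 A) a b ↔ b ≤ a := Iff.rfl

@[simp] theorem comp_rel {A B D : FinScottL.{u}} (R : A ⟶ B) (S : B ⟶ D) (a : A) (d : D) :
    Hom.rel (R ≫ S) a d ↔ ∃ b, R.rel a b ∧ S.rel b d := Iff.rfl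

/-- The morphism `{(a, b) | b ≤ f a}` induced by a monotone map `f`. -/
def ofMap {A B : FinScottL.{u}} (f : A →o B) : A ⟶ B :=
  Hom.mk (fun a b => b ≤ f a) (fun h h₁ h₂ => h₂.trans (h.trans (f.monotone h₁)))

@[simp] theorem ofMap_comp_rel {A B D : FinScottL.{u}} (f : A →o B) (R : B ⟶ D) (a : A) (d : D) :
    Hom.rel (ofMap f ≫ R) a d ↔ R.rel (f a) d :=
  ⟨fun ⟨_, h, h'⟩ => down R h' h le_rfl, fun h => ⟨f a, le_rfl, h⟩⟩

/-- The isomorphism induced by an isomorphism of preorders. -/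
@[simps]
def ofIso {A B : FinScottL.{u}} (e : A ≃o B) : A ≅ B where
  hom := ofMap e.toOrderEmbedding.toOrderHom
  inv := ofMap e.symm.toOrderEmbedding.toOrderHom
  hom_inv_id := hom_ext fun a b => by rw [ofMap_comp_rel]; simp [ofMap]
  inv_hom_id := hom_ext fun a b => by rw [ofMap_comp_rel]; simp [ofMap]

/-! ### The tensor product -/

/-- `A ⊗ B`, the product of preorders. -/
def tensor (A B : FinScottL.{u}) : FinScottL.{u} := ⟨A × B⟩

/-- `1`, the one-point preorder. -/
def one : FinScottL.{u} := ⟨PUnit⟩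

/-- `R ⊗ S` relates `(a, b)` to `(a', b')` iff `R` relates `a` to `a'` and `S` relates `b`
to `b'`. -/
def tensorMap {A A' B B' : FinScottL.{u}} (R : A ⟶ A') (S : B ⟶ B') :
    tensor A B ⟶ tensor A' B' :=
  Hom.mk (fun (p : A × B) (q : A' × B') => R.rel p.1 q.1 ∧ S.rel p.2 q.2)
    (fun h h₁ h₂ => ⟨down R h.1 h₁.1 h₂.1, down S h.2 h₁.2 h₂.2⟩)

/-- `(A × B) × D ≃ A × (B × D)` as preorders. -/
def assocIso (A B D : FinScottL.{u}) : tensor (tensor A B) D ≃o tensor A (tensor B D) where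
  toEquiv := Equiv.prodAssoc A B D
  map_rel_iff' := ⟨fun h => ⟨⟨h.1, h.2.1⟩, h.2.2⟩, fun h => ⟨h.1.1, h.1.2, h.2⟩⟩

def leftUnitIso (A : FinScottL.{u}) : tensor one A ≃o A where
  toEquiv := Equiv.punitProd A
  map_rel_iff' := ⟨fun h => ⟨le_rfl, h⟩, fun h => h.2⟩

def rightUnitIso (A : FinScottL.{u}) : tensor A one ≃o A where
  toEquiv := Equiv.prodPUnit A
  map_rel_iff' := ⟨fun h => ⟨h, le_rfl⟩, fun h => h.1⟩

instance : MonoidalCategoryStruct FinScottL.{u} where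
  tensorObj := tensor
  tensorUnit := one
  tensorHom := tensorMap
  whiskerLeft A _ _ R := tensorMap (𝟙 A) R
  whiskerRight R B := tensorMap R (𝟙 B)
  associator A B D := ofIso (assocIso A B D)
  leftUnitor A := ofIso (leftUnitIso A)
  rightUnitor A := ofIso (rightUnitIso A)

theorem tensorMap_comp {A A' A'' B B' B'' : FinScottL.{u}} (R : A ⟶ A') (R' : A' ⟶ A'')
    (S : B ⟶ B') (S' : B' ⟶ B'') :
    tensorMap R S ≫ tensorMap R' S' = tensorMap (R ≫ R') (S ≫ S') :=
  hom_ext fun _ _ => ⟨fun ⟨m, h, h'⟩ => ⟨⟨m.1, h.1, h'.1⟩, ⟨m.2, h.2, h'.2⟩⟩,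
    fun ⟨⟨x, h, h'⟩, ⟨y, k, k'⟩⟩ => ⟨(x, y), ⟨h, k⟩, ⟨h', k'⟩⟩⟩

theorem comp_ofIso_rel {A B D : FinScottL.{u}} (R : A ⟶ B) (e : B ≃o D) (a : A) (d : D) :
    Hom.rel (R ≫ (ofIso e).hom) a d ↔ R.rel a (e.symm d) :=
  ⟨fun ⟨_, h, h'⟩ => down R h le_rfl (e.symm_apply_le.2 h'),
    fun h => ⟨_, h, (e.apply_symm_apply d).ge⟩⟩

instance : MonoidalCategory FinScottL.{u} := MonoidalCategory.ofTensorHom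
  (id_tensorHom_id := fun _ _ => rfl)
  (id_tensorHom := fun _ _ _ _ => rfl)
  (tensorHom_id := fun _ _ => rfl)
  (tensorHom_comp_tensorHom := fun _ _ _ _ => tensorMap_comp _ _ _ _)
  (associator_naturality := fun _ _ _ => hom_ext fun a b => by
    rw [show (α_ _ _ _) = ofIso (assocIso _ _ _) from rfl, comp_ofIso_rel,
      show (α_ _ _ _) = ofIso (assocIso _ _ _) from rfl, ofIso_hom, ofMap_comp_rel]
    exact and_assoc)
  (leftUnitor_naturality := fun f => hom_ext fun a b => by
    rw [show (λ_ _) = ofIso (leftUnitIso _) from rfl, comp_ofIso_rel,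
      show (λ_ _) = ofIso (leftUnitIso _) from rfl, ofIso_hom, ofMap_comp_rel]
    exact ⟨fun h => h.2, fun h => ⟨le_rfl, h⟩⟩)
  (rightUnitor_naturality := fun f => hom_ext fun a b => by
    rw [show (ρ_ _) = ofIso (rightUnitIso _) from rfl, comp_ofIso_rel,
      show (ρ_ _) = ofIso (rightUnitIso _) from rfl, ofIso_hom, ofMap_comp_rel]
    exact ⟨fun h => h.1, fun h => ⟨h, le_rfl⟩⟩)
  (pentagon := fun W X Y Z => hom_ext fun a b => by
    constructor
    · rintro ⟨m, ⟨⟨h₁, h₂, h₃⟩, h₄⟩, n, ⟨k₁, ⟨k₂, k₃⟩, k₄⟩, ⟨l₁, l₂, l₃, l₄⟩⟩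
      exact ⟨((a.1.1.1, a.1.1.2), (a.1.2, a.2)), ⟨⟨le_rfl, le_rfl⟩, le_rfl, le_rfl⟩,
        l₁.trans (k₁.trans h₁), l₂.trans (k₂.trans h₂), l₃.trans (k₃.trans h₃),
        l₄.trans (k₄.trans h₄)⟩
    · rintro ⟨m, ⟨⟨h₁, h₂⟩, h₃, h₄⟩, ⟨l₁, l₂, l₃, l₄⟩⟩
      exact ⟨((a.1.1.1, (a.1.1.2, a.1.2)), a.2), ⟨⟨le_rfl, le_rfl, le_rfl⟩, le_rfl⟩,
        (a.1.1.1, ((a.1.1.2, a.1.2), a.2)), ⟨le_rfl, ⟨le_rfl, le_rfl⟩, le_rfl⟩,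
        l₁.trans h₁, l₂.trans h₂, l₃.trans h₃, l₄.trans h₄⟩)
  (triangle := fun X Y => hom_ext fun a b => by
    constructor
    · rintro ⟨m, ⟨h₁, h₂, h₃⟩, l₁, l₂⟩
      exact ⟨l₁.trans h₁, l₂.trans h₃⟩
    · rintro ⟨l₁, l₂⟩
      exact ⟨(a.1.1, (a.1.2, a.2)), ⟨le_rfl, le_rfl, le_rfl⟩, l₁, l₂⟩)

@[simp] theorem whiskerLeft_rel {A B B' : FinScottL.{u}} (R : B ⟶ B') (p : A × B) (q : A × B') :
    Hom.rel (A ◁ R) p q ↔ q.1 ≤ p.1 ∧ R.rel p.2 q.2 := Iff.rfl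

@[simp] theorem whiskerRight_rel {A A' B : FinScottL.{u}} (R : A ⟶ A') (p : A × B)
    (q : A' × B) : Hom.rel (R ▷ B) p q ↔ R.rel p.1 q.1 ∧ q.2 ≤ p.2 := Iff.rfl

/-! ### The cartesian product -/

/-- `A & B`, the disjoint union of preorders. -/
def withObj (A B : FinScottL.{u}) : FinScottL.{u} := ⟨A ⊕ B⟩

/-- `⊤`, the empty preorder. -/
def top : FinScottL.{u} := ⟨PEmpty⟩

def proj₁ (A B : FinScottL.{u}) : withObj A B ⟶ A :=
  Hom.mk (fun (z : A ⊕ B) a => Sum.inl a ≤ z) (fun h h₁ h₂ => (Sum.inl_le_inl_iff.2 h₂).trans (h.trans h₁))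

def proj₂ (A B : FinScottL.{u}) : withObj A B ⟶ B :=
  Hom.mk (fun (z : A ⊕ B) b => Sum.inr b ≤ z) (fun h h₁ h₂ => (Sum.inr_le_inr_iff.2 h₂).trans (h.trans h₁))

def pair {T A B : FinScottL.{u}} (R : T ⟶ A) (S : T ⟶ B) : T ⟶ withObj A B :=
  Hom.mk (fun t (z : A ⊕ B) => Sum.elim (R.rel t) (S.rel t) z) (by
    rintro t t' (a | b) (a' | b') h h₁ h₂
    · exact down R h h₁ (Sum.inl_le_inl_iff.1 h₂)
    · exact (Sum.not_inr_le_inl h₂).elim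
    · exact (Sum.not_inl_le_inr h₂).elim
    · exact down S h h₁ (Sum.inr_le_inr_iff.1 h₂))

theorem comp_proj₁_rel {T A B : FinScottL.{u}} (R : T ⟶ withObj A B) (t : T) (a : A) :
    Hom.rel (R ≫ proj₁ A B) t a ↔ R.rel t (Sum.inl a) :=
  ⟨fun ⟨_, h, h'⟩ => down R h le_rfl h', fun h => ⟨_, h, le_rfl⟩⟩

theorem comp_proj₂_rel {T A B : FinScottL.{u}} (R : T ⟶ withObj A B) (t : T) (b : B) :
    Hom.rel (R ≫ proj₂ A B) t b ↔ R.rel t (Sum.inr b) :=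
  ⟨fun ⟨_, h, h'⟩ => down R h le_rfl h', fun h => ⟨_, h, le_rfl⟩⟩

theorem pair_proj₁ {T A B : FinScottL.{u}} (R : T ⟶ A) (S : T ⟶ B) :
    pair R S ≫ proj₁ A B = R := hom_ext fun t a => comp_proj₁_rel _ t a

theorem pair_proj₂ {T A B : FinScottL.{u}} (R : T ⟶ A) (S : T ⟶ B) :
    pair R S ≫ proj₂ A B = S := hom_ext fun t a => comp_proj₂_rel _ t a

theorem with_ext {T A B : FinScottL.{u}} {R S : T ⟶ withObj A B}
    (h₁ : R ≫ proj₁ A B = S ≫ proj₁ A B) (h₂ : R ≫ proj₂ A B = S ≫ proj₂ A B) : R = S :=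
  hom_ext fun t z => by
    rcases z with a | b
    · exact (comp_proj₁_rel R t a).symm.trans ((by rw [h₁] : _ ↔ _).trans (comp_proj₁_rel S t a))
    · exact (comp_proj₂_rel R t b).symm.trans ((by rw [h₂] : _ ↔ _).trans (comp_proj₂_rel S t b))

/-! ### The exponential comonad -/

/-- The finite subsets of `α`. -/
structure Bang (α : Type u) : Type u where
  elems : Finset α

namespace Bang

instance {α : Type u} : Membership α (Bang α) := ⟨fun s a => a ∈ s.elems⟩

instance {α : Type u} [Finite α] : Finite (Bang α) :=
  Finite.of_injective Bang.elems fun s t h => by cases s; cases t; exact congrArg _ h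

/-- `s ≤ t` iff every element of `s` is below some element of `t`. -/
instance {α : Type u} [Preorder α] : Preorder (Bang α) where
  le s t := ∀ a ∈ s, ∃ b ∈ t, a ≤ b
  le_refl _ a ha := ⟨a, ha, le_rfl⟩
  le_trans _ _ _ h h' a ha :=
    let ⟨b, hb, hab⟩ := h a ha
    let ⟨c, hc, hbc⟩ := h' b hb
    ⟨c, hc, hab.trans hbc⟩

theorem le_def {α : Type u} [Preorder α] {s t : Bang α} : s ≤ t ↔ ∀ a ∈ s, ∃ b ∈ t, a ≤ b :=
  Iff.rfl

/-- A subset of a finite type, as an element of `Bang`. -/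
noncomputable def ofSet {α : Type u} [Finite α] (s : Set α) : Bang α := ⟨s.toFinite.toFinset⟩

@[simp] theorem mem_ofSet {α : Type u} [Finite α] (s : Set α) (a : α) : a ∈ ofSet s ↔ a ∈ s :=
  Set.Finite.mem_toFinset _

instance {α : Type u} : Singleton α (Bang α) := ⟨fun a => ⟨{a}⟩⟩

theorem self_mem {α : Type u} (a : α) : a ∈ ({a} : Bang α) := Finset.mem_singleton_self a

theorem eq_of_mem {α : Type u} {a b : α} (h : a ∈ ({b} : Bang α)) : a = b :=
  Finset.mem_singleton.1 h

/-- The direct image of a finite subset under a relation. -/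
noncomputable def img {α β : Type u} [Finite β] (R : α → β → Prop) (s : Bang α) : Bang β :=
  ofSet {b | ∃ a ∈ s, R a b}

theorem mem_img {α β : Type u} [Finite β] {R : α → β → Prop} {s : Bang α} {b : β} :
    b ∈ img R s ↔ ∃ a ∈ s, R a b := mem_ofSet _ _

end Bang

/-- `!A`. -/
def bangObj (A : FinScottL.{u}) : FinScottL.{u} := ⟨Bang A⟩

/-- `!R = {(s, t) | ∀ b ∈ t, ∃ a ∈ s, (a, b) ∈ R}`. -/
def bangMap {A B : FinScottL.{u}} (R : A ⟶ B) : bangObj A ⟶ bangObj B :=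
  Hom.mk (fun (s : Bang A) (t : Bang B) => ∀ b ∈ t, ∃ a ∈ s, R.rel a b) (by
    intro s s' t t' h h₁ h₂ b hb
    obtain ⟨b', hb', hbb'⟩ := h₂ b hb
    obtain ⟨a, ha, hab⟩ := h b' hb'
    obtain ⟨a', ha', haa'⟩ := h₁ a ha
    exact ⟨a', ha', down R hab haa' hbb'⟩)

theorem bangMap_comp {A B D : FinScottL.{u}} (R : A ⟶ B) (S : B ⟶ D) :
    bangMap (R ≫ S) = bangMap R ≫ bangMap S := hom_ext fun s t => by
  constructor
  · intro h
    refine ⟨Bang.img R.rel s, fun b hb => Bang.mem_img.1 hb, fun d hd => ?_⟩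
    obtain ⟨a, ha, b, hab, hbd⟩ := h d hd
    exact ⟨b, Bang.mem_img.2 ⟨a, ha, hab⟩, hbd⟩
  · rintro ⟨m, h, h'⟩ d hd
    obtain ⟨b, hb, hbd⟩ := h' d hd
    obtain ⟨a, ha, hab⟩ := h b hb
    exact ⟨a, ha, b, hab, hbd⟩

/-- Dereliction `{(s, a') | ∃ a ∈ s, a' ≤ a} : !A ⟶ A`. -/
def bangDer (A : FinScottL.{u}) : bangObj A ⟶ A :=
  Hom.mk (fun (s : Bang A) a' => ∃ a ∈ s, a' ≤ a) (by
    rintro s s' a a' ⟨b, hb, hab⟩ h₁ h₂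
    obtain ⟨b', hb', hbb'⟩ := h₁ b hb
    exact ⟨b', hb', h₂.trans (hab.trans hbb')⟩)

/-- Digging `{(s, S) | ∀ t ∈ S, t ≤ s} : !A ⟶ !!A`. -/
def bangDig (A : FinScottL.{u}) : bangObj A ⟶ bangObj (bangObj A) :=
  Hom.mk (fun (s : Bang A) (S : Bang (Bang A)) => ∀ t ∈ S, t ≤ s) (by
    intro s s' S S' h h₁ h₂ t ht
    obtain ⟨t', ht', htt'⟩ := h₂ t ht
    exact htt'.trans ((h t' ht').trans h₁))

/-- The comonad `!`. -/
def bang : Comonad FinScottL.{u} where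
  obj := bangObj
  map := bangMap
  map_id _ := rfl
  map_comp := bangMap_comp
  ε := { app := bangDer
         naturality := fun A B R => hom_ext fun s b => by
          constructor
          · rintro ⟨t, h, b', hb', hbb'⟩
            obtain ⟨a, ha, hab⟩ := h b' hb'
            exact ⟨a, ⟨a, ha, le_rfl⟩, down R hab le_rfl hbb'⟩
          · rintro ⟨a, ⟨a', ha', haa'⟩, hab⟩
            exact ⟨({b} : Bang B), fun x hx => ⟨a', ha', down R hab haa' (Bang.eq_of_mem hx).le⟩,
              b, Bang.self_mem _, le_rfl⟩ }
  δ := { app := bangDig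
         naturality := fun A B R => hom_ext fun s T => by
          constructor
          · rintro ⟨t, h, h'⟩
            refine ⟨({s} : Bang (Bang A)), fun x hx => (Bang.eq_of_mem hx).le, fun t' ht' => ⟨s, Bang.self_mem _, ?_⟩⟩
            exact down (bangMap R) h le_rfl (h' t' ht')
          · rintro ⟨S, h, h'⟩
            refine ⟨Bang.img R.rel s, fun b hb => Bang.mem_img.1 hb,
              fun t ht b hb => ?_⟩
            obtain ⟨s', hs', hst⟩ := h' t ht
            obtain ⟨a, ha, hab⟩ := hst b hb
            obtain ⟨a', ha', haa'⟩ := h s' hs' a ha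
            exact ⟨b, Bang.mem_img.2 ⟨a', ha', down R hab haa' le_rfl⟩, le_rfl⟩ }
  coassoc A := hom_ext fun s T => by
    constructor
    · rintro ⟨S, h, h'⟩
      refine ⟨({s} : Bang (Bang A)), fun t ht => (Bang.eq_of_mem ht).le, fun t ht x hx => ⟨s, Bang.self_mem _, ?_⟩⟩
      obtain ⟨b, hb, hbt⟩ := h' t ht
      exact (hbt x hx).trans (h b hb)
    · rintro ⟨S, h, h'⟩
      refine ⟨({s} : Bang (Bang A)), fun t ht => (Bang.eq_of_mem ht).le, fun t ht => ⟨s, Bang.self_mem _, ?_⟩⟩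
      intro x hx
      obtain ⟨y, hy, hxy⟩ := h' t ht x hx
      exact hxy.trans (h y hy)
  left_counit A := hom_ext fun s t => by
    constructor
    · rintro ⟨S, h, t', ht', htt'⟩
      exact htt'.trans (h t' ht')
    · intro h
      exact ⟨({t} : Bang (Bang A)), fun x hx => (Bang.eq_of_mem hx).le.trans h, t, Bang.self_mem _, le_rfl⟩
  right_counit A := hom_ext fun s t => by
    constructor
    · rintro ⟨S, h, h'⟩ a ha
      obtain ⟨x, hx, y, hy, hay⟩ := h' a ha
      obtain ⟨b, hb, hyb⟩ := h x hx y hy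
      exact ⟨b, hb, hay.trans hyb⟩
    · intro h
      refine ⟨({s} : Bang (Bang A)), fun x hx => (Bang.eq_of_mem hx).le, fun a ha => ⟨s, Bang.self_mem _, h a ha⟩⟩

/-! ### The colouring comonad -/

/-- The colours: the finitely many natural numbers in `C`, together with a neutral colour `⊥`
which is smaller than all of them. -/
abbrev Col (C : Finset ℕ) : Type := WithBot C

/-- The pairs of a colour and an element of `α`. -/
@[ext]
structure Box (C : Finset ℕ) (α : Type u) : Type u where
  col : Col C
  val : α

instance {C : Finset ℕ} {α : Type u} [Finite α] : Finite (Box C α) :=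
  Finite.of_injective (fun x : Box C α => ((x.col, x.val) : Col C × α)) fun _ _ h =>
    Box.ext (congrArg Prod.fst h) (congrArg Prod.snd h)

/-- Elements of different colours are incomparable. -/
instance {C : Finset ℕ} {α : Type u} [Preorder α] : Preorder (Box C α) where
  le x y := x.col = y.col ∧ x.val ≤ y.val
  le_refl _ := ⟨rfl, le_rfl⟩
  le_trans _ _ _ h h' := ⟨h.1.trans h'.1, h.2.trans h'.2⟩

section

variable (C : Finset ℕ)

/-- `□A`. -/
def boxObj (A : FinScottL.{u}) : FinScottL.{u} := ⟨Box C A⟩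

/-- `□R` relates `(i, a)` to `(j, b)` iff `i = j` and `R` relates `a` to `b`. -/
def boxMap {A B : FinScottL.{u}} (R : A ⟶ B) : boxObj C A ⟶ boxObj C B :=
  Hom.mk (fun (x : Box C A) (y : Box C B) => x.col = y.col ∧ R.rel x.val y.val)
    (fun h h₁ h₂ => ⟨h₁.1.symm.trans (h.1.trans h₂.1.symm), down R h.2 h₁.2 h₂.2⟩)

/-- `{((ε, a), a') | a' ≤ a} : □A ⟶ A`. -/
def boxDer (A : FinScottL.{u}) : boxObj C A ⟶ A :=
  Hom.mk (fun (x : Box C A) a' => x.col = ⊥ ∧ a' ≤ x.val)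
    (fun h h₁ h₂ => ⟨h₁.1.symm.trans h.1, h₂.trans (h.2.trans h₁.2)⟩)

/-- `{((max c₁ c₂, a), (c₁, (c₂, a'))) | a' ≤ a} : □A ⟶ □□A`. -/
def boxDig (A : FinScottL.{u}) : boxObj C A ⟶ boxObj C (boxObj C A) :=
  Hom.mk (fun (x : Box C A) (y : Box C (Box C A)) =>
      x.col = max y.col y.val.col ∧ y.val.val ≤ x.val)
    (fun h h₁ h₂ => ⟨by rw [← h₁.1, h.1, h₂.1, h₂.2.1], h₂.2.2.trans (h.2.trans h₁.2)⟩)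

/-- The comonad `□`. -/
def box : Comonad FinScottL.{u} where
  obj := boxObj C
  map := boxMap C
  map_id _ := hom_ext fun _ _ => and_congr_left' eq_comm
  map_comp R S := hom_ext fun x z =>
    ⟨fun ⟨h, b, h₁, h₂⟩ => ⟨⟨x.col, b⟩, ⟨rfl, h₁⟩, h, h₂⟩,
      fun ⟨y, ⟨h, h₁⟩, h', h₂⟩ => ⟨h.trans h', y.val, h₁, h₂⟩⟩
  ε := { app := boxDer C
         naturality := fun A B R => hom_ext fun x b =>
          ⟨fun ⟨y, ⟨h, h₁⟩, h', h₂⟩ => ⟨x.val, ⟨h.trans h', le_rfl⟩, down R h₁ le_rfl h₂⟩,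
            fun ⟨a, ⟨h, h'⟩, h₁⟩ => ⟨⟨x.col, b⟩, ⟨rfl, down R h₁ h' le_rfl⟩, h, le_rfl⟩⟩ }
  δ := { app := boxDig C
         naturality := fun A B R => hom_ext fun x z =>
          ⟨fun ⟨y, ⟨h, h₁⟩, h', h₂⟩ => ⟨⟨z.col, ⟨z.val.col, x.val⟩⟩, ⟨h.trans h', le_rfl⟩,
              rfl, rfl, down R h₁ le_rfl h₂⟩,
            fun ⟨y, ⟨h, h₁⟩, h', h'', h₂⟩ => ⟨⟨x.col, z.val.val⟩, ⟨rfl, down R h₂ h₁ le_rfl⟩,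
              by rw [h, h', h''], le_rfl⟩⟩ }
  coassoc A := hom_ext fun x w =>
    ⟨fun ⟨y, ⟨h, h₁⟩, h', h₂⟩ =>
        ⟨⟨max w.col w.val.col, ⟨w.val.val.col, x.val⟩⟩,
          ⟨h.trans ((congrArg₂ max h' h₂.1).trans (max_assoc _ _ _).symm), le_rfl⟩,
          rfl, rfl, h₂.2.trans h₁⟩,
      fun ⟨y, ⟨h, h₁⟩, h', h₂⟩ =>
        ⟨⟨w.col, ⟨max w.val.col w.val.val.col, x.val⟩⟩,
          ⟨h.trans ((congrArg₂ max h' h₂.1.symm).trans (max_assoc _ _ _)), le_rfl⟩,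
          rfl, rfl, h₂.2.trans h₁⟩⟩
  left_counit A := hom_ext fun x z =>
    ⟨fun ⟨y, ⟨h, h₁⟩, h', h₂⟩ => ⟨by rw [h, h', h₂.1, bot_sup_eq], h₂.2.trans h₁⟩,
      fun ⟨h, h₁⟩ => ⟨⟨⊥, z⟩, ⟨by rw [← h, bot_sup_eq], h₁⟩, rfl, le_rfl⟩⟩
  right_counit A := hom_ext fun x z =>
    ⟨fun ⟨y, ⟨h, h₁⟩, h', h₂⟩ => ⟨by rw [h, h', h₂.1, sup_bot_eq], h₂.2.trans h₁⟩,
      fun ⟨h, h₁⟩ => ⟨⟨z.col, ⟨⊥, z.val⟩⟩, ⟨by rw [← h, sup_bot_eq], h₁⟩, rfl, rfl, le_rfl⟩⟩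

/-- The distributive law `λ : !□A ⟶ □!A`, which relates `s` to `(c, t)` iff every `a ∈ t`
is below some `a'` with `(c, a') ∈ s`. -/
def distrib (A : FinScottL.{u}) : bangObj (boxObj C A) ⟶ boxObj C (bangObj A) :=
  Hom.mk (fun (s : Bang (Box C A)) (y : Box C (Bang A)) =>
      ∀ a ∈ y.val, ∃ x ∈ s, y.col = x.col ∧ a ≤ x.val) (by
    intro s s' y y' h h₁ h₂ a ha
    obtain ⟨b, hb, hab⟩ := h₂.2 a ha
    obtain ⟨x, hx, hc, hbx⟩ := h b hb
    obtain ⟨x', hx', hc', hxx'⟩ := h₁ x hx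
    exact ⟨x', hx', h₂.1.trans (hc.trans hc'), hab.trans (hbx.trans hxx')⟩)

/-! ### The coloured exponential -/

/-- The coloured exponential `!□A`. -/
def colObj (A : FinScottL.{u}) : FinScottL.{u} := bangObj (boxObj C A)

def colMap {A B : FinScottL.{u}} (R : A ⟶ B) : colObj C A ⟶ colObj C B := bangMap (boxMap C R)

/-- The counit of `!□`. -/
def colDer (A : FinScottL.{u}) : colObj C A ⟶ A := bangMap (boxDer C A) ≫ bangDer A

/-- The comultiplication `!□A ⟶ !□□A ⟶ !!□□A ⟶ !□!□A` of `!□`, obtained from the comultiplications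
of `□` and `!` and from the distributive law. -/
def colDig (A : FinScottL.{u}) : colObj C A ⟶ colObj C (colObj C A) :=
  bangMap (boxDig C A) ≫ bangDig (boxObj C (boxObj C A)) ≫ bangMap (distrib C (boxObj C A))

variable {C}

/-- `□_c s ≤ u`: painting `s` with the colour `c` gives something below `u`. -/
def Bang.Paint {α : Type u} [Preorder α] (c : Col C) (s u : Bang (Box C α)) : Prop :=
  ∀ z ∈ s, ∃ x ∈ u, x.col = max c z.col ∧ z.val ≤ x.val

/-- The largest `s` with `□_c s ≤ u`. -/
noncomputable def Bang.unpaint {α : Type u} [Preorder α] [Finite α] (c : Col C)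
    (u : Bang (Box C α)) : Bang (Box C α) :=
  Bang.ofSet {z | ∃ x ∈ u, x.col = max c z.col ∧ z.val ≤ x.val}

theorem Bang.unpaint_paint {α : Type u} [Preorder α] [Finite α] (c : Col C)
    (u : Bang (Box C α)) : Bang.Paint c (Bang.unpaint c u) u :=
  fun z hz => (Bang.mem_ofSet _ z).1 hz

theorem Bang.Paint.mem {α : Type u} [Preorder α] [Finite α] {c : Col C}
    {s u : Bang (Box C α)} (h : Bang.Paint c s u) {z : Box C α} (hz : z ∈ s) :
    z ∈ Bang.unpaint c u := (Bang.mem_ofSet _ _).2 (h z hz)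

theorem Bang.Paint.mono {α : Type u} [Preorder α] {c : Col C}
    {s s' u u' : Bang (Box C α)} (h : Bang.Paint c s u) (hs : s' ≤ s) (hu : u ≤ u') :
    Bang.Paint c s' u' := fun z hz => by
  obtain ⟨y, hy, hzy, hzy'⟩ := hs z hz
  obtain ⟨x, hx, hxy, hxy'⟩ := h y hy
  obtain ⟨w, hw, hxw, hxw'⟩ := hu x hx
  exact ⟨w, hw, by rw [← hxw, hxy, hzy], hzy'.trans (hxy'.trans hxw')⟩

theorem Bang.Paint.trans {α : Type u} [Preorder α] {c d : Col C}
    {s t u : Bang (Box C α)} (h : Bang.Paint c s t) (h' : Bang.Paint d t u) :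
    Bang.Paint (max d c) s u := fun z hz => by
  obtain ⟨y, hy, hzy, hzy'⟩ := h z hz
  obtain ⟨x, hx, hxy, hxy'⟩ := h' y hy
  exact ⟨x, hx, by rw [hxy, hzy, max_assoc], hzy'.trans hxy'⟩

theorem Bang.paint_bot {α : Type u} [Preorder α] {s u : Bang (Box C α)} :
    Bang.Paint ⊥ s u ↔ s ≤ u := by
  constructor
  · intro h z hz
    obtain ⟨x, hx, h₁, h₂⟩ := h z hz
    exact ⟨x, hx, by rw [h₁, bot_sup_eq], h₂⟩
  · intro h z hz
    obtain ⟨x, hx, h₁, h₂⟩ := h z hz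
    exact ⟨x, hx, by rw [bot_sup_eq, h₁], h₂⟩

theorem colMap_rel {A B : FinScottL.{u}} (R : A ⟶ B) (s : Bang (Box C A)) (t : Bang (Box C B)) :
    (colMap C R).rel s t ↔ ∀ y ∈ t, ∃ x ∈ s, x.col = y.col ∧ R.rel x.val y.val := Iff.rfl

theorem colDer_rel {A : FinScottL.{u}} (s : Bang (Box C A)) (a : A) :
    (colDer C A).rel s a ↔ ∃ x ∈ s, x.col = ⊥ ∧ a ≤ x.val := by
  constructor
  · rintro ⟨t, h, b, hb, hab⟩
    obtain ⟨x, hx, hc, hbx⟩ := h b hb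
    exact ⟨x, hx, hc, hab.trans hbx⟩
  · rintro ⟨x, hx, hc, hax⟩
    exact ⟨({a} : Bang A), fun b hb => ⟨x, hx, hc, (Bang.eq_of_mem hb).le.trans hax⟩, a,
      Bang.self_mem _, le_rfl⟩

theorem colDig_rel {A : FinScottL.{u}} (u : Bang (Box C A)) (U : Bang (Box C (Bang (Box C A)))) :
    (colDig C A).rel u U ↔ ∀ y ∈ U, Bang.Paint y.col y.val u := by
  constructor
  · rintro ⟨V, h, W, h', h''⟩ y hy z hz
    obtain ⟨t, ht, k⟩ := h'' y hy
    obtain ⟨x, hx, hxy, hzx⟩ := k z hz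
    obtain ⟨x', hx', hxx', hxx''⟩ := h' t ht x hx
    obtain ⟨p, hp, hpx, hpx'⟩ := h x' hx'
    exact ⟨p, hp, by rw [hpx, ← hxx', hxy, hzx.1, hxx''.1], hzx.2.trans (hxx''.2.trans hpx')⟩
  · intro h
    let V : Bang (Box C (Box C A)) := Bang.img (boxDig C A).rel u
    refine ⟨V, fun b hb => Bang.mem_img.1 hb, ({V} : Bang (Bang (Box C (Box C A)))),
      fun t ht => (Bang.eq_of_mem ht).le, fun y hy => ⟨V, Bang.self_mem _, fun z hz => ?_⟩⟩
    obtain ⟨x, hx, hc, hzx⟩ := h y hy z hz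
    exact ⟨(⟨y.col, z⟩ : Box C (Box C A)), Bang.mem_img.2 ⟨x, hx, hc, hzx⟩, rfl, le_rfl⟩

/-- The promotion `!□A ⟶ !□B` of `R : !□A ⟶ B`. -/
def prom {A B : FinScottL.{u}} (R : colObj C A ⟶ B) : colObj C A ⟶ colObj C B :=
  colDig C A ≫ colMap C R

theorem prom_rel {A B : FinScottL.{u}} (R : colObj C A ⟶ B) (u : Bang (Box C A))
    (t : Bang (Box C B)) :
    (prom R).rel u t ↔ ∀ y ∈ t, R.rel (Bang.unpaint y.col u) y.val := by
  constructor
  · rintro ⟨U, h, h'⟩ y hy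
    obtain ⟨x, hx, hxy, hR⟩ := h' y hy
    exact down R hR (fun z hz => ⟨z, hxy ▸ ((colDig_rel u U).1 h x hx).mem hz, le_rfl⟩) le_rfl
  · intro h
    refine ⟨(Bang.ofSet {y | Bang.Paint y.col y.val u} : Bang (Box C (Bang (Box C A)))),
      (colDig_rel _ _).2 fun y hy => (Bang.mem_ofSet _ _).1 hy, fun y hy => ?_⟩
    exact ⟨(⟨y.col, Bang.unpaint y.col u⟩ : Box C (Bang (Box C A))),
      (Bang.mem_ofSet _ _).2 (Bang.unpaint_paint _ _), rfl, h y hy⟩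

end

/-- The comonad `!□`. -/
def colBang (C : Finset ℕ) : Comonad FinScottL.{u} where
  obj := colObj C
  map := colMap C
  map_id A := ((congrArg bangMap ((box C).map_id A)).trans (bang.map_id _) : _)
  map_comp R S := ((congrArg bangMap ((box C).map_comp R S)).trans (bangMap_comp _ _) : _)
  ε := { app := colDer C
         naturality := fun A B R => hom_ext fun s b => by
          rw [comp_rel, comp_rel]
          constructor
          · rintro ⟨t, h, h'⟩
            obtain ⟨y, hy, hc, hby⟩ := (colDer_rel _ _).1 h'
            obtain ⟨x, hx, hxy, hR⟩ := h y hy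
            exact ⟨x.val, (colDer_rel _ _).2 ⟨x, hx, hxy.trans hc, le_rfl⟩, down R hR le_rfl hby⟩
          · rintro ⟨a, h, hR⟩
            obtain ⟨x, hx, hc, hax⟩ := (colDer_rel _ _).1 h
            exact ⟨({⟨⊥, b⟩} : Bang (Box C B)), fun y hy => ⟨x, hx, by
              obtain rfl := Bang.eq_of_mem hy; exact ⟨hc, down R hR hax le_rfl⟩⟩,
              (colDer_rel _ _).2 ⟨⟨⊥, b⟩, Bang.self_mem _, rfl, le_rfl⟩⟩ }
  δ := { app := colDig C
         naturality := fun A B R => hom_ext fun s T => by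
          refine Iff.trans ?_ (prom_rel (colMap C R) s T).symm
          constructor
          · rintro ⟨t, h, h'⟩ y hy z hz
            obtain ⟨x, hx, hxy, hzx⟩ := (colDig_rel _ _).1 h' y hy z hz
            obtain ⟨p, hp, hpx, hR⟩ := h x hx
            exact ⟨⟨z.col, p.val⟩, (Bang.mem_ofSet _ _).2 ⟨p, hp, hpx.trans hxy, le_rfl⟩,
              rfl, down R hR le_rfl hzx⟩
          · intro h
            refine ⟨Bang.img (boxMap C R).rel s, fun y hy => Bang.mem_img.1 hy,
              (colDig_rel _ _).2 fun y hy z hz => ?_⟩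
            obtain ⟨x, hx, hxz, hR⟩ := h y hy z hz
            obtain ⟨p, hp, hpx, hxp⟩ := (Bang.mem_ofSet _ _).1 hx
            exact ⟨⟨max y.col z.col, z.val⟩, Bang.mem_img.2 ⟨p, hp, by rw [hpx, hxz],
              down R hR hxp le_rfl⟩, rfl, le_rfl⟩ }
  coassoc A := hom_ext fun s T => by
    refine (prom_rel (colDig C A) s T).trans ?_
    constructor
    · intro h
      refine ⟨(Bang.ofSet {y | Bang.Paint y.col y.val s} : Bang (Box C (Bang (Box C A)))),
        (colDig_rel _ _).2 fun y hy => (Bang.mem_ofSet _ _).1 hy,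
        (colDig_rel _ _).2 fun y hy z hz => ?_⟩
      have := (colDig_rel _ _).1 (h y hy) z hz
      exact ⟨(⟨max y.col z.col, z.val⟩ : Box C (Bang (Box C A))),
        (Bang.mem_ofSet _ _).2 (this.trans (Bang.unpaint_paint _ _)), rfl, le_rfl⟩
    · rintro ⟨U, h, h'⟩ y hy
      refine (colDig_rel _ _).2 fun z hz p hp => ?_
      obtain ⟨x, hx, hxy, hzx⟩ := (colDig_rel _ _).1 h' y hy z hz
      obtain ⟨q, hq, hpq, hpq'⟩ := hzx p hp
      obtain ⟨r, hr, hrq, hrq'⟩ := (colDig_rel _ _).1 h x hx q hq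
      exact ⟨⟨max z.col p.col, p.val⟩, (Bang.mem_ofSet _ _).2 ⟨r, hr, by
        rw [hrq, hxy, ← hpq, max_assoc], hpq'.trans hrq'⟩, rfl, le_rfl⟩
  left_counit A := hom_ext fun s t => by
    constructor
    · rintro ⟨U, h, h'⟩
      obtain ⟨y, hy, hc, hty⟩ := (colDer_rel _ _).1 h'
      have := (colDig_rel _ _).1 h y hy
      rw [hc] at this
      exact hty.trans (Bang.paint_bot.1 this)
    · intro h
      refine ⟨({⟨⊥, t⟩} : Bang (Box C (Bang (Box C A)))), (colDig_rel _ _).2 fun y hy => ?_,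
        (colDer_rel _ _).2 ⟨_, Bang.self_mem _, rfl, le_rfl⟩⟩
      obtain rfl := Bang.eq_of_mem hy
      exact Bang.paint_bot.2 h
  right_counit A := hom_ext fun s t => by
    refine (prom_rel (colDer C A) s t).trans (forall₂_congr fun y hy => ?_)
    rw [colDer_rel]
    constructor
    · rintro ⟨x, hx, hc, hyx⟩
      obtain ⟨p, hp, hpx, hxp⟩ := (Bang.mem_ofSet _ _).1 hx
      exact ⟨p, hp, by rw [hpx, hc, sup_bot_eq], hyx.trans hxp⟩
    · rintro ⟨x, hx, hc, hyx⟩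
      exact ⟨⟨⊥, y.val⟩, (Bang.mem_ofSet _ _).2 ⟨x, hx, by rw [sup_bot_eq]; exact hc.symm, hyx⟩,
        rfl, le_rfl⟩

/-! ### The Seely isomorphisms and contraction -/

section

variable {C : Finset ℕ}

/-- The disjoint union of a finite subset of `Col × α` and a finite subset of `Col × β`. -/
noncomputable def Bang.merge {α β : Type u} [Finite α] [Finite β] (s : Bang (Box C α))
    (t : Bang (Box C β)) : Bang (Box C (α ⊕ β)) :=
  Bang.ofSet {y | Sum.elim (fun a => (⟨y.col, a⟩ : Box C α) ∈ s)
    (fun b => (⟨y.col, b⟩ : Box C β) ∈ t) y.val}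

/-- The part in `α` of a finite subset of `Col × (α ⊎ β)`. -/
noncomputable def Bang.left {α β : Type u} [Finite α] (s : Bang (Box C (α ⊕ β))) : Bang (Box C α) :=
  Bang.ofSet {x | (⟨x.col, Sum.inl x.val⟩ : Box C (α ⊕ β)) ∈ s}

/-- The part in `β` of a finite subset of `Col × (α ⊎ β)`. -/
noncomputable def Bang.right {α β : Type u} [Finite β] (s : Bang (Box C (α ⊕ β))) :
    Bang (Box C β) :=
  Bang.ofSet {x | (⟨x.col, Sum.inr x.val⟩ : Box C (α ⊕ β)) ∈ s}

theorem Bang.ext {α : Type u} {s t : Bang α} (h : ∀ a, a ∈ s ↔ a ∈ t) : s = t := by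
  cases s; cases t
  exact congrArg _ (Finset.ext h)

theorem Bang.inl_mem_merge {α β : Type u} [Finite α] [Finite β] {s : Bang (Box C α)}
    {t : Bang (Box C β)} {c : Col C} {a : α} :
    (⟨c, Sum.inl a⟩ : Box C (α ⊕ β)) ∈ Bang.merge s t ↔ (⟨c, a⟩ : Box C α) ∈ s :=
  Bang.mem_ofSet _ _

theorem Bang.inr_mem_merge {α β : Type u} [Finite α] [Finite β] {s : Bang (Box C α)}
    {t : Bang (Box C β)} {c : Col C} {b : β} :
    (⟨c, Sum.inr b⟩ : Box C (α ⊕ β)) ∈ Bang.merge s t ↔ (⟨c, b⟩ : Box C β) ∈ t :=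
  Bang.mem_ofSet _ _

theorem Bang.mem_left {α β : Type u} [Finite α] {s : Bang (Box C (α ⊕ β))} {c : Col C} {a : α} :
    (⟨c, a⟩ : Box C α) ∈ s.left ↔ (⟨c, Sum.inl a⟩ : Box C (α ⊕ β)) ∈ s := Bang.mem_ofSet _ _

theorem Bang.mem_right {α β : Type u} [Finite β] {s : Bang (Box C (α ⊕ β))} {c : Col C} {b : β} :
    (⟨c, b⟩ : Box C β) ∈ s.right ↔ (⟨c, Sum.inr b⟩ : Box C (α ⊕ β)) ∈ s := Bang.mem_ofSet _ _

/-- Disjoint union is an isomorphism of preorders. -/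
noncomputable def mergeIso (α β : Type u) [Preorder α] [Preorder β] [Finite α] [Finite β] :
    Bang (Box C α) × Bang (Box C β) ≃o Bang (Box C (α ⊕ β)) where
  toFun p := Bang.merge p.1 p.2
  invFun s := (s.left, s.right)
  left_inv p := Prod.ext (Bang.ext fun ⟨_, _⟩ => Bang.mem_left.trans Bang.inl_mem_merge)
    (Bang.ext fun ⟨_, _⟩ => Bang.mem_right.trans Bang.inr_mem_merge)
  right_inv s := Bang.ext fun y => by
    rcases y with ⟨c, a | b⟩
    · exact Bang.inl_mem_merge.trans Bang.mem_left
    · exact Bang.inr_mem_merge.trans Bang.mem_right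
  map_rel_iff' := by
    rintro ⟨s, t⟩ ⟨s', t'⟩
    constructor
    · intro h
      constructor
      · rintro ⟨c, a⟩ hx
        obtain ⟨⟨d, a' | b'⟩, hy, hc, hxy⟩ := h ⟨c, Sum.inl a⟩ (Bang.inl_mem_merge.2 hx)
        · exact ⟨⟨d, a'⟩, Bang.inl_mem_merge.1 hy, hc, Sum.inl_le_inl_iff.1 hxy⟩
        · exact (Sum.not_inl_le_inr hxy).elim
      · rintro ⟨c, b⟩ hx
        obtain ⟨⟨d, a' | b'⟩, hy, hc, hxy⟩ := h ⟨c, Sum.inr b⟩ (Bang.inr_mem_merge.2 hx)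
        · exact (Sum.not_inr_le_inl hxy).elim
        · exact ⟨⟨d, b'⟩, Bang.inr_mem_merge.1 hy, hc, Sum.inr_le_inr_iff.1 hxy⟩
    · rintro ⟨h, h'⟩ ⟨c, a | b⟩ hy
      · obtain ⟨⟨d, a'⟩, hx, hc, hax⟩ := h _ (Bang.inl_mem_merge.1 hy)
        exact ⟨⟨d, Sum.inl a'⟩, Bang.inl_mem_merge.2 hx, hc, Sum.inl_le_inl_iff.2 hax⟩
      · obtain ⟨⟨d, b'⟩, hx, hc, hbx⟩ := h' _ (Bang.inr_mem_merge.1 hy)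
        exact ⟨⟨d, Sum.inr b'⟩, Bang.inr_mem_merge.2 hx, hc, Sum.inr_le_inr_iff.2 hbx⟩

/-- The Seely isomorphism `!□A ⊗ !□B ≅ !□(A & B)`. -/
noncomputable def seely (A B : FinScottL.{u}) :
    colObj C A ⊗ colObj C B ≅ colObj C (withObj A B) :=
  ofIso (A := tensor (colObj C A) (colObj C B)) (B := colObj C (withObj A B)) (mergeIso A B)

/-- Contraction `!□A ⟶ !□(A & A) ≅ !□A ⊗ !□A`. -/
noncomputable def con (A : FinScottL.{u}) : colObj C A ⟶ colObj C A ⊗ colObj C A :=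
  colMap C (pair (𝟙 A) (𝟙 A)) ≫ (seely A A).inv

/-- The promotion `!□X ⊗ !□A ≅ !□(X & A) ⟶ !□B` of `g : !□X ⊗ !□A ⟶ B`. -/
noncomputable def prom₂ {X A B : FinScottL.{u}} (g : colObj C X ⊗ colObj C A ⟶ B) :
    colObj C X ⊗ colObj C A ⟶ colObj C B :=
  (seely X A).hom ≫ prom ((seely X A).inv ≫ g)

/-- The parametrised composite `f ⋆ g : !□X ⊗ !□A ⟶ A` of `f : !□X ⊗ !□B ⟶ A` and
`g : !□X ⊗ !□A ⟶ B`. -/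
noncomputable def star {X A B : FinScottL.{u}} (f : colObj C X ⊗ colObj C B ⟶ A)
    (g : colObj C X ⊗ colObj C A ⟶ B) : colObj C X ⊗ colObj C A ⟶ A :=
  con X ▷ colObj C A ≫ (α_ (colObj C X) (colObj C X) (colObj C A)).hom ≫
    colObj C X ◁ prom₂ g ≫ f

end

/-- Conway operators over `FinScottL`, for the exponential `!□`. -/
structure IsConwayOperator (C : Finset ℕ)
    (Y : ∀ X A : FinScottL.{u}, (colObj C X ⊗ colObj C A ⟶ A) → (colObj C X ⟶ A)) : Prop where
  /-- naturality in the parameter -/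
  natural : ∀ {X Z A : FinScottL.{u}} (g : colObj C X ⟶ Z) (f : colObj C Z ⊗ colObj C A ⟶ A),
    Y X A (prom g ▷ colObj C A ≫ f) = prom g ≫ Y Z A f
  /-- the parametrised fixpoint property -/
  fixpoint : ∀ {X A : FinScottL.{u}} (f : colObj C X ⊗ colObj C A ⟶ A),
    Y X A f = con X ≫ colObj C X ◁ prom (Y X A f) ≫ f
  /-- parametrised dinaturality -/
  dinatural : ∀ {X A B : FinScottL.{u}} (f : colObj C X ⊗ colObj C B ⟶ A)
    (g : colObj C X ⊗ colObj C A ⟶ B),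
    Y X A (star f g) = con X ≫ colObj C X ◁ prom (Y X B (star g f)) ≫ f
  /-- the diagonal property -/
  diagonal : ∀ {X A : FinScottL.{u}} (f : (colObj C X ⊗ colObj C A) ⊗ colObj C A ⟶ A),
    Y X A ((seely X A).hom ≫ Y (withObj X A) A ((seely X A).inv ▷ colObj C A ≫ f)) =
      Y X A (colObj C X ◁ con A ≫ (α_ (colObj C X) (colObj C A) (colObj C A)).inv ≫ f)

/-! ### Semantic run-trees and the fixpoint operator -/

/-- A finitely branching, possibly infinite tree whose nodes carry a label in `L` and a colour.
Nodes are addressed by the lists of child indices read from the node up to the root: `[]` is the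
root and `i :: p` is the child number `i` of `p`, for `i < arity p`. Only the values of `arity`,
`label` and `col` at nodes matter. -/
structure ColTree (C : Finset ℕ) (L : Type u) where
  arity : List ℕ → ℕ
  label : List ℕ → L
  col : List ℕ → Col C

namespace ColTree

variable {C : Finset ℕ} {L : Type u} (t : ColTree C L)

/-- The addresses of the nodes of the tree. -/
def IsNode : List ℕ → Prop
  | [] => True
  | i :: p => IsNode p ∧ i < t.arity p

/-- The maximal colour on the path from a node to the root, both included. -/
def pathCol : List ℕ → Col C
  | [] => t.col []
  | i :: p => max (t.col (i :: p)) (pathCol p)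

/-- The node at depth `n` of the branch which takes the child number `s k` at depth `k`. -/
def pos (s : ℕ → ℕ) : ℕ → List ℕ
  | 0 => []
  | n + 1 => s n :: pos s n

/-- Every infinite branch has a non-neutral colour occurring infinitely often, and the greatest
such colour is even. -/
def Winning : Prop :=
  ∀ s : ℕ → ℕ, (∀ n, t.IsNode (pos s n)) →
    ∃ c : C, (∃ᶠ n in Filter.atTop, t.col (pos s n) = (c : Col C)) ∧
      (∀ d : C, (∃ᶠ n in Filter.atTop, t.col (pos s n) = (d : Col C)) → d ≤ c) ∧ Even (c : ℕ)

variable {X A : FinScottL.{u}} (t : ColTree C (X ⊕ A))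

/-- The set of pairs of the colour and the label of the children of `p` with a label in `X`. -/
noncomputable def childrenX (p : List ℕ) : Bang (Box C X) :=
  Bang.ofSet {y | ∃ i < t.arity p, t.col (i :: p) = y.col ∧ t.label (i :: p) = Sum.inl y.val}

/-- The set of pairs of the colour and the label of the children of `p` with a label in `A`. -/
noncomputable def childrenA (p : List ℕ) : Bang (Box C A) :=
  Bang.ofSet {y | ∃ i < t.arity p, t.col (i :: p) = y.col ∧ t.label (i :: p) = Sum.inr y.val}

/-- `t` is a semantic run-tree of `R` producing `a`. When the node in `step` is a leaf, both sets
of children are empty. -/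
structure IsRunTree (R : colObj C X ⊗ colObj C A ⟶ A) (a : A) : Prop where
  root_label : t.label [] = Sum.inr a
  root_col : t.col [] = ⊥
  inner : ∀ p, t.IsNode p → 0 < t.arity p → ∃ b, t.label p = Sum.inr b
  step : ∀ p b, t.IsNode p → t.label p = Sum.inr b → R.rel (t.childrenX p, t.childrenA p) b

/-- The set of pairs `(c, x)` for `x` the label in `X` of a leaf and `c` the maximal colour on
the path from this leaf to the root. -/
def leaves : Set (Box C X) :=
  {y | ∃ p, t.IsNode p ∧ t.label p = Sum.inl y.val ∧ t.pathCol p = y.col}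

end ColTree
/-- `(u, a)` is in `Y(R)` iff `u` is the set of leaves of some winning semantic run-tree of `R`
producing `a`. -/
def fixRel {C : Finset ℕ} {X A : FinScottL.{u}} (R : colObj C X ⊗ colObj C A ⟶ A)
    (s : Bang (Box C X)) (a : A) : Prop :=
  ∃ t : ColTree C (X ⊕ A), t.IsRunTree R a ∧ t.Winning ∧ t.leaves = {y | y ∈ s}

namespace ColTree

variable {C : Finset ℕ} {X A : FinScottL.{u}} (t : ColTree C (X ⊕ A)) (a : A) (f : Box C X → X)
  (l : List (Box C X))

/-- The leaves added in `modify`. -/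
def extra : List ℕ → Option (Box C X)
  | [i] => if t.arity [] ≤ i then l[i - t.arity []]? else none
  | _ => none

/-- Relabel the root of `t` with `a`, relabel its leaves in `X` by means of `f`, and add the
elements of the list `l` as leaves below the root. -/
def modify : ColTree C (X ⊕ A) where
  arity p := if p = [] then t.arity [] + l.length else
    (t.extra l p).elim (t.arity p) fun _ => 0
  label p := if p = [] then Sum.inr a else
    (t.extra l p).elim ((t.label p).map (fun x => f ⟨t.pathCol p, x⟩) id) fun y => Sum.inl y.val
  col p := (t.extra l p).elim (t.col p) Box.col

theorem extra_eq_some {p : List ℕ} {y : Box C X} :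
    t.extra l p = some y ↔ ∃ j, p = [t.arity [] + j] ∧ l[j]? = some y := by
  constructor
  · intro h
    match p with
    | [] => simp [extra] at h
    | [i] =>
      by_cases hi : t.arity [] ≤ i
      · exact ⟨i - t.arity [], by simp [hi], by simpa [extra, hi] using h⟩
      · simp [extra, hi] at h
    | i :: j :: q => simp [extra] at h
  · rintro ⟨j, rfl, h⟩
    simpa [extra] using h

theorem extra_of_isNode {p : List ℕ} (hp : t.IsNode p) : t.extra l p = none := by
  rw [Option.eq_none_iff_forall_ne_some]
  intro y h
  obtain ⟨j, rfl, -⟩ := (t.extra_eq_some l).1 h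
  have := hp.2
  omega

theorem modify_arity {p : List ℕ} (hp : t.IsNode p) (h : p ≠ []) :
    (t.modify a f l).arity p = t.arity p := by
  simp [modify, h, t.extra_of_isNode l hp]

theorem modify_label {p : List ℕ} (hp : t.IsNode p) (h : p ≠ []) :
    (t.modify a f l).label p = (t.label p).map (fun x => f ⟨t.pathCol p, x⟩) id := by
  simp [modify, h, t.extra_of_isNode l hp]

theorem modify_col {p : List ℕ} (hp : t.IsNode p) : (t.modify a f l).col p = t.col p := by
  simp [modify, t.extra_of_isNode l hp]

theorem modify_isNode {p : List ℕ} :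
    (t.modify a f l).IsNode p ↔ t.IsNode p ∨ ∃ y, t.extra l p = some y := by
  induction p with
  | nil => simp [IsNode]
  | cons i p ih =>
    rw [IsNode, ih]
    constructor
    · rintro ⟨h | ⟨y, hy⟩, hi⟩
      · by_cases hp : p = []
        · subst hp
          by_cases hi' : i < t.arity []
          · exact Or.inl ⟨h, hi'⟩
          · simp only [modify, if_true] at hi
            exact Or.inr ⟨l[i - t.arity []], (t.extra_eq_some l).2 ⟨i - t.arity [], by
              rw [Nat.add_sub_cancel' (by omega)], by simp⟩⟩
        · rw [modify_arity t a f l h hp] at hi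
          exact Or.inl ⟨h, hi⟩
      · exfalso
        have hp : p ≠ [] := by rintro rfl; simp [extra] at hy
        simp [modify, hp, hy] at hi
    · rintro (⟨h, hi⟩ | ⟨y, hy⟩)
      · refine ⟨Or.inl h, ?_⟩
        by_cases hp : p = []
        · subst hp
          simp only [modify, if_true]
          omega
        · rwa [modify_arity t a f l h hp]
      · obtain ⟨j, hj, hy'⟩ := (t.extra_eq_some l).1 hy
        obtain ⟨rfl, rfl⟩ := List.cons.inj hj
        have := (List.getElem?_eq_some_iff.1 hy').1
        refine ⟨Or.inl trivial, ?_⟩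
        simp only [modify, if_true]
        omega

theorem modify_pathCol {p : List ℕ} (hp : t.IsNode p) :
    (t.modify a f l).pathCol p = t.pathCol p := by
  induction p with
  | nil => exact modify_col t a f l hp
  | cons i p ih => rw [pathCol, pathCol, ih hp.1, modify_col t a f l hp]

theorem modify_winning (h : t.Winning) : (t.modify a f l).Winning := by
  intro s hs
  have hn : ∀ n, t.IsNode (pos s n) := by
    intro n
    rcases (modify_isNode t a f l).1 (hs n) with h | ⟨y, hy⟩
    · exact h
    · exfalso
      have h' := (hs (n + 1)).2
      have hp : pos s n ≠ [] := by intro h0; simp [h0, extra] at hy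
      simp [modify, hp, hy] at h'
  simpa only [modify_col t a f l (hn _)] using h s hn

theorem modify_isRunTree {R : colObj C X ⊗ colObj C A ⟶ A} {a₀ : A} (h : t.IsRunTree R a₀)
    (ha : a ≤ a₀) (hf : ∀ y ∈ t.leaves, y.val ≤ f y) : (t.modify a f l).IsRunTree R a where
  root_label := rfl
  root_col := h.root_col
  inner p hp h0 := by
    by_cases hp0 : p = []
    · exact ⟨a, by subst hp0; rfl⟩
    rcases (modify_isNode t a f l).1 hp with hn | ⟨y, hy⟩
    · rw [modify_arity t a f l hn hp0] at h0
      obtain ⟨b, hb⟩ := h.inner p hn h0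
      exact ⟨b, by rw [modify_label t a f l hn hp0, hb]; rfl⟩
    · simp [modify, hp0, hy] at h0
  step p b hp hb := by
    rcases (modify_isNode t a f l).1 hp with hn | ⟨y, hy⟩
    · have key : ∀ b', t.label p = Sum.inr b' → b ≤ b' → R.rel
          ((t.modify a f l).childrenX p, (t.modify a f l).childrenA p) b := by
        intro b' hb' hbb'
        have ar : t.arity p ≤ (t.modify a f l).arity p := by
          by_cases hp0 : p = []
          · subst hp0
            simp [modify]
          · rw [modify_arity t a f l hn hp0]
        refine down R (h.step p b' hn hb') ⟨fun y hy => ?_, fun y hy => ?_⟩ hbb'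
        · obtain ⟨i, hi, hc, hl⟩ := (Bang.mem_ofSet _ y).1 hy
          have hin : t.IsNode (i :: p) := ⟨hn, hi⟩
          have hpc := hf ⟨t.pathCol (i :: p), y.val⟩ ⟨i :: p, hin, hl, rfl⟩
          refine ⟨⟨y.col, f ⟨t.pathCol (i :: p), y.val⟩⟩, (Bang.mem_ofSet _ _).2
            ⟨i, hi.trans_le ar, ?_, ?_⟩, rfl, hpc⟩
          · rw [modify_col t a f l hin, hc]
          · rw [modify_label t a f l hin (by simp), hl]
            rfl
        · obtain ⟨i, hi, hc, hl⟩ := (Bang.mem_ofSet _ y).1 hy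
          have hin : t.IsNode (i :: p) := ⟨hn, hi⟩
          refine ⟨y, (Bang.mem_ofSet _ _).2 ⟨i, hi.trans_le ar, ?_, ?_⟩, le_rfl⟩
          · rw [modify_col t a f l hin, hc]
          · rw [modify_label t a f l hin (by simp), hl]
            rfl
      by_cases hp0 : p = []
      · subst hp0
        obtain rfl : a = b := Sum.inr.inj hb
        exact key a₀ h.root_label ha
      · rw [modify_label t a f l hn hp0] at hb
        rcases hl : t.label p with x | b'
        · rw [hl] at hb
          cases hb
        · rw [hl] at hb
          obtain rfl : b' = b := Sum.inr.inj hb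
          exact key b' hl le_rfl
    · exfalso
      have hp0 : p ≠ [] := by rintro rfl; simp [extra] at hy
      simp [modify, hp0, hy] at hb

theorem modify_leaves {R : colObj C X ⊗ colObj C A ⟶ A} {a₀ : A} (h : t.IsRunTree R a₀)
    (hf : ∀ y ∈ t.leaves, (⟨y.col, f y⟩ : Box C X) ∈ l) :
    (t.modify a f l).leaves = {y | y ∈ l} := by
  ext y
  constructor
  · rintro ⟨p, hp, hl, hc⟩
    have hp0 : p ≠ [] := by rintro rfl; cases hl
    rcases (modify_isNode t a f l).1 hp with hn | ⟨z, hz⟩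
    · rw [modify_label t a f l hn hp0] at hl
      rw [modify_pathCol t a f l hn] at hc
      rcases hx : t.label p with x | b
      · rw [hx] at hl
        have := hf ⟨t.pathCol p, x⟩ ⟨p, hn, hx, rfl⟩
        have e : f ⟨t.pathCol p, x⟩ = y.val := Sum.inl.inj hl
        rw [e] at this
        have e' : (⟨t.pathCol p, y.val⟩ : Box C X) = y := Box.ext hc rfl
        exact e' ▸ this
      · rw [hx] at hl
        cases hl
    · obtain ⟨j, rfl, hj⟩ := (t.extra_eq_some l).1 hz
      have e : z = y := by
        refine Box.ext ?_ ?_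
        · rw [← hc]
          simp [pathCol, modify, hj, extra, h.root_col]
        · simpa [modify, hz] using hl
      exact e ▸ List.mem_of_getElem? hj
  · intro hy
    obtain ⟨j, hj⟩ := List.mem_iff_getElem?.1 hy
    have hz := (t.extra_eq_some l).2 ⟨j, rfl, hj⟩
    refine ⟨[t.arity [] + j], (modify_isNode t a f l).2 (Or.inr ⟨y, hz⟩), ?_, ?_⟩
    · simp [modify, hz]
    · simp [pathCol, modify, hj, extra, h.root_col]

end ColTree

/-- The fixpoint operator. -/
def fixOp (C : Finset ℕ) (X A : FinScottL.{u}) (R : colObj C X ⊗ colObj C A ⟶ A) :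
    colObj C X ⟶ A :=
  Hom.mk (fixRel R) (by
    classical
    rintro s s' a a' ⟨t, ht, hw, hl⟩ h₁ h₂
    have hex : ∀ y : Box C X, ∃ x : X, y ∈ t.leaves →
        y.val ≤ x ∧ (⟨y.col, x⟩ : Box C X) ∈ (id s' : Bang (Box C X)).elems.toList := by
      intro y
      by_cases hy : y ∈ t.leaves
      · have hy' := hy
        rw [hl] at hy'
        obtain ⟨z, hz, hc, hyz⟩ := h₁ y hy'
        refine ⟨z.val, fun _ => ⟨hyz, Finset.mem_toList.2 ?_⟩⟩
        have e : (⟨y.col, z.val⟩ : Box C X) = z := Box.ext hc rfl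
        exact e ▸ hz
      · exact ⟨y.val, fun h => (hy h).elim⟩
    choose f hf using hex
    refine ⟨t.modify a' f (id s' : Bang (Box C X)).elems.toList,
      t.modify_isRunTree _ _ _ ht h₂ fun y hy => (hf y hy).1, t.modify_winning _ _ _ hw, ?_⟩
    rw [t.modify_leaves _ _ _ ht fun y hy => (hf y hy).2]
    ext y
    exact Finset.mem_toList)

/-! ### The Kleisli category of `!□` and its cartesian closed structure -/

theorem comp_der_of {C : Finset ℕ} {A B : Cokleisli (colBang.{u} C)} {D : FinScottL.{u}}
    (f : A ⟶ B) (R : B.of ⟶ D) :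
    (f ≫ (Cokleisli.Hom.mk (colDer C B.of ≫ R) : B ⟶ Cokleisli.mk (colBang C) D)).of = f.of ≫ R := by
  have h₁ := (colBang C).ε.naturality f.of
  have h₂ := (colBang C).left_counit A.of
  change (colBang C).δ.app A.of ≫ (colBang C).map f.of ≫ (colBang C).ε.app B.of ≫ R = _
  rw [← Category.assoc ((colBang C).map f.of), h₁, Category.assoc, ← Category.assoc, h₂,
    Category.id_comp]
  rfl

open Limits in
/-- The product of `A` and `B` in the Kleisli category is `A & B`. -/
def kleisliProd {C : Finset ℕ} (A B : Cokleisli (colBang.{u} C)) : LimitCone (Limits.pair A B) where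
  cone := BinaryFan.mk (P := Cokleisli.mk (colBang C) (withObj A.of B.of))
    (Cokleisli.Hom.mk (colDer C _ ≫ proj₁ A.of B.of))
    (Cokleisli.Hom.mk (colDer C _ ≫ proj₂ A.of B.of))
  isLimit := BinaryFan.IsLimit.mk _
    (fun f g => Cokleisli.Hom.mk (FinScottL.pair f.of g.of))
    (fun f g => Cokleisli.hom_ext _ (by
      exact (comp_der_of _ _).trans (pair_proj₁ _ _)))
    (fun f g => Cokleisli.hom_ext _ (by
      exact (comp_der_of _ _).trans (pair_proj₂ _ _)))
    (fun f g m h₁ h₂ => Cokleisli.hom_ext _ (with_ext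
      (by
        rw [pair_proj₁]
        exact (comp_der_of _ _).symm.trans (congrArg Cokleisli.Hom.of h₁))
      (by
        rw [pair_proj₂]
        exact (comp_der_of _ _).symm.trans (congrArg Cokleisli.Hom.of h₂))))

open Limits in
/-- The terminal object of the Kleisli category is `⊤`. -/
def kleisliTop (C : Finset ℕ) : LimitCone (Functor.empty.{0} (Cokleisli (colBang.{u} C))) where
  cone := asEmptyCone (Cokleisli.mk (colBang C) top)
  isLimit := IsTerminal.ofUniqueHom
    (fun _ => Cokleisli.Hom.mk (Hom.mk (fun _ _ => False) (fun h _ _ => h)))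
    (fun _ _ => Cokleisli.hom_ext _ (hom_ext fun _ b => PEmpty.elim b))

instance (C : Finset ℕ) : CartesianMonoidalCategory (Cokleisli (colBang.{u} C)) :=
  CartesianMonoidalCategory.ofChosenFiniteProducts (kleisliTop C) kleisliProd

/-- `A ⊸ B`, that is, `Aᵒᵖ × B`. -/
def lolli (A B : FinScottL.{u}) : FinScottL.{u} := ⟨Aᵒᵈ × B⟩

/-- Morphisms `A ⊗ B ⟶ D` are the same as morphisms `B ⟶ (A ⊸ D)`. -/
def linCurry (A B D : FinScottL.{u}) : (A ⊗ B ⟶ D) ≃ (B ⟶ lolli A D) where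
  toFun R := Hom.mk (fun (b : B) (p : Aᵒᵈ × D) => R.rel (OrderDual.ofDual p.1, b) p.2)
    (fun h h₁ h₂ => down R h ⟨h₂.1, h₁⟩ h₂.2)
  invFun S := Hom.mk (fun (p : A × B) (d : D) => S.rel p.2 (OrderDual.toDual p.1, d))
    (fun h h₁ h₂ => down S h h₁.2 ⟨h₁.1, h₂⟩)
  left_inv _ := rfl
  right_inv _ := rfl

section

variable {C : Finset ℕ}

theorem seely_hom_comp_rel {A B D : FinScottL.{u}} (R : colObj C (withObj A B) ⟶ D)
    (p : Bang (Box C A) × Bang (Box C B)) (d : D) :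
    Hom.rel ((seely A B).hom ≫ R) p d ↔ R.rel (Bang.merge p.1 p.2) d :=
  ofMap_comp_rel (A := tensor (colObj C A) (colObj C B)) (B := colObj C (withObj A B)) _ R p d

theorem comp_seely_hom_rel {A B D : FinScottL.{u}} (R : D ⟶ colObj C A ⊗ colObj C B)
    (d : D) (s : Bang (Box C (A ⊕ B))) :
    Hom.rel (R ≫ (seely A B).hom) d s ↔ R.rel d (s.left, s.right) :=
  comp_ofIso_rel (B := tensor (colObj C A) (colObj C B)) (D := colObj C (withObj A B)) R
    (mergeIso A B) d s

theorem colMap_proj₂_comp_rel {A B D : FinScottL.{u}} (R : colObj C B ⟶ D)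
    (s : Bang (Box C (A ⊕ B))) (d : D) :
    Hom.rel (colMap C (proj₂ A B) ≫ R) s d ↔ R.rel s.right d := by
  constructor
  · rintro ⟨t, h, h'⟩
    refine down R h' (fun y hy => ?_) le_rfl
    obtain ⟨⟨c, a | b⟩, hx, hc, hxy⟩ := h y hy
    · exact (Sum.not_inr_le_inl hxy).elim
    · exact ⟨⟨c, b⟩, Bang.mem_right.2 hx, hc.symm, Sum.inr_le_inr_iff.1 hxy⟩
  · intro h
    refine ⟨s.right, fun y hy => ⟨⟨y.col, Sum.inr y.val⟩, Bang.mem_right.1 hy, rfl, ?_⟩, h⟩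
    exact (le_rfl : (Sum.inr y.val : A ⊕ B) ≤ Sum.inr y.val)

theorem unpaint_merge_right {α β : Type u} [Preorder α] [Preorder β] [Finite α] [Finite β]
    (c : Col C) (s : Bang (Box C α)) (t : Bang (Box C β)) :
    (Bang.unpaint c (Bang.merge s t)).right = Bang.unpaint c t := by
  refine Bang.ext fun z => (Bang.mem_ofSet _ z).trans ((Bang.mem_ofSet _ _).trans
    (Iff.trans ?_ (Bang.mem_ofSet _ z).symm))
  constructor
  · rintro ⟨⟨d, a | b⟩, hx, hc, hzx⟩
    · exact (Sum.not_inr_le_inl hzx).elim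
    · exact ⟨⟨d, b⟩, Bang.inr_mem_merge.1 hx, hc, Sum.inr_le_inr_iff.1 hzx⟩
  · rintro ⟨⟨d, b⟩, hx, hc, hzx⟩
    exact ⟨⟨d, Sum.inr b⟩, Bang.inr_mem_merge.2 hx, hc, Sum.inr_le_inr_iff.2 hzx⟩

theorem seely_prom {A B B' : FinScottL.{u}} (f : colObj C B ⟶ B') :
    (seely A B).hom ≫ prom (pair (colDer C (withObj A B) ≫ proj₁ A B)
      (colMap C (proj₂ A B) ≫ f)) = colObj C A ◁ prom f ≫ (seely A B').hom := by
  refine hom_ext fun p s => (seely_hom_comp_rel _ p s).trans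
    (((prom_rel _ _ _).trans ?_).trans (comp_seely_hom_rel _ p s).symm)
  constructor
  · intro h
    refine ⟨?_, (prom_rel f p.2 (Bang.right s)).2 ?_⟩
    · rintro ⟨c, a⟩ hx
      obtain ⟨z, hz, haz⟩ := h ⟨c, Sum.inl a⟩ (Bang.mem_left.1 hx)
      obtain ⟨w, hw, hc, hzw⟩ := (colDer_rel _ _).1 hz
      obtain ⟨⟨d, a' | b'⟩, hv, hvw, hvw'⟩ := (Bang.mem_ofSet _ _).1 hw
      · exact ⟨⟨d, a'⟩, Bang.inl_mem_merge.1 hv, by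
          rw [hc, sup_bot_eq] at hvw; exact hvw.symm,
          Sum.inl_le_inl_iff.1 (le_trans haz (hzw.trans hvw'))⟩
      · exact (Sum.not_inl_le_inr (le_trans haz (hzw.trans hvw'))).elim
    · rintro ⟨c, b⟩ hx
      have := (colMap_proj₂_comp_rel f _ b).1 (h ⟨c, Sum.inr b⟩ (Bang.mem_right.1 hx))
      exact (congrArg (fun w => f.rel w b) (unpaint_merge_right c p.1 p.2)).mp this
  · rintro ⟨h₁, h₂⟩ ⟨c, a | b⟩ hy
    · obtain ⟨⟨d, a'⟩, hx, hc, hax⟩ := h₁ ⟨c, a⟩ (Bang.mem_left.2 hy)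
      refine ⟨Sum.inl a, (colDer_rel _ _).2 ⟨⟨⊥, Sum.inl a⟩, (Bang.mem_ofSet _ _).2
        ⟨⟨d, Sum.inl a'⟩, Bang.inl_mem_merge.2 hx, ?_, Sum.inl_le_inl_iff.2 hax⟩, rfl, le_rfl⟩,
        (le_rfl : (Sum.inl a : A ⊕ B) ≤ Sum.inl a)⟩
      rw [sup_bot_eq]
      exact hc.symm
    · refine (colMap_proj₂_comp_rel f _ b).2 ?_
      refine (congrArg (fun w => f.rel w b) (unpaint_merge_right c p.1 p.2)).mpr ?_
      exact (prom_rel f p.2 (Bang.right s)).1 h₂ ⟨c, b⟩ (Bang.mem_right.2 hy)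

theorem whisker_of (A : Cokleisli (colBang.{u} C)) {B B' : Cokleisli (colBang.{u} C)}
    (f : B ⟶ B') :
    (A ◁ f).of = pair (colDer C (withObj A.of B.of) ≫ proj₁ A.of B.of)
      (colMap C (proj₂ A.of B.of) ≫ f.of) := by
  refine with_ext ?_ ?_
  · refine Eq.trans ?_ (pair_proj₁ _ _).symm
    refine (comp_der_of (A ◁ f) (proj₁ A.of B'.of)).symm.trans ?_
    exact congrArg Cokleisli.Hom.of (CartesianMonoidalCategory.whiskerLeft_fst A f)
  · refine Eq.trans ?_ (pair_proj₂ _ _).symm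
    refine (comp_der_of (A ◁ f) (proj₂ A.of B'.of)).symm.trans ?_
    refine (congrArg Cokleisli.Hom.of (CartesianMonoidalCategory.whiskerLeft_snd A f)).trans ?_
    have h := (colBang C).right_counit (withObj A.of B.of)
    change (colBang C).δ.app (withObj A.of B.of) ≫ (colBang C).map
      ((colBang C).ε.app (withObj A.of B.of) ≫ proj₂ A.of B.of) ≫ f.of = _
    rw [Functor.map_comp, Category.assoc, ← Category.assoc, h, Category.id_comp]
    rfl

/-- Currying in the Kleisli category: the exponential of `A` and `Y` is `!□A ⊸ Y`. -/
noncomputable def kleisliCurry (A X Y : Cokleisli (colBang.{u} C)) :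
    ((tensorLeft A).obj X ⟶ Y) ≃ (X ⟶ Cokleisli.mk (colBang C) (lolli (colObj C A.of) Y.of)) where
  toFun f := Cokleisli.Hom.mk (linCurry _ _ _ ((seely A.of X.of).hom ≫ f.of))
  invFun g := Cokleisli.Hom.mk ((seely A.of X.of).inv ≫ (linCurry _ _ _).symm g.of)
  left_inv f := Cokleisli.hom_ext _ (by
    exact (congrArg ((seely A.of X.of).inv ≫ ·) (Equiv.symm_apply_apply _ _)).trans
      (Iso.inv_hom_id_assoc _ _))
  right_inv g := Cokleisli.hom_ext _ (by
    exact (congrArg (linCurry _ _ _) (Iso.hom_inv_id_assoc _ _)).trans (Equiv.apply_symm_apply _ _))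

theorem linCurry_natural {A B B' D : FinScottL.{u}} (f : B ⟶ B') (g : A ⊗ B' ⟶ D) :
    linCurry A B D (A ◁ f ≫ g) = f ≫ linCurry A B' D g :=
  hom_ext fun b p => by
    constructor
    · rintro ⟨⟨a', b'⟩, ⟨ha, hb⟩, h⟩
      exact ⟨b', hb, down g h ⟨ha, le_rfl⟩ le_rfl⟩
    · rintro ⟨b', hb, h⟩
      exact ⟨(OrderDual.ofDual p.1, b'), ⟨le_rfl, hb⟩, h⟩

theorem kleisliCurry_natural (A : Cokleisli (colBang.{u} C)) (X' X Y : Cokleisli (colBang.{u} C))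
    (f : X' ⟶ X) (g : (tensorLeft A).obj X ⟶ Y) :
    kleisliCurry A X' Y ((tensorLeft A).map f ≫ g) = f ≫ kleisliCurry A X Y g := by
  refine Cokleisli.hom_ext _ ?_
  have h₁ : (seely A.of X'.of).hom ≫ ((tensorLeft A).map f ≫ g).of =
      colObj C A.of ◁ prom f.of ≫ (seely A.of X.of).hom ≫ g.of := by
    have h := congrArg (· ≫ g.of) (seely_prom (A := A.of) f.of)
    rw [← whisker_of A f] at h
    exact (congrArg ((seely A.of X'.of).hom ≫ ·) (Category.assoc _ _ _).symm).trans
      ((Category.assoc _ _ _).symm.trans (h.trans (Category.assoc _ _ _)))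
  refine (congrArg (linCurry _ _ _) h₁).trans ((linCurry_natural _ _).trans ?_)
  exact Category.assoc _ _ _

noncomputable instance : MonoidalClosed (Cokleisli (colBang.{u} C)) where
  closed A :=
    { rightAdj := Adjunction.rightAdjointOfEquiv (kleisliCurry A) (kleisliCurry_natural A)
      adj := Adjunction.adjunctionOfEquivRight (kleisliCurry A) (kleisliCurry_natural A) }

end

/-- The fixpoint operator on the Kleisli category: a morphism from the product of `X` and `A`
is turned into a morphism from `!□X ⊗ !□A` by means of the Seely isomorphism. -/
noncomputable def kleisliFix (C : Finset ℕ) (X A : Cokleisli (colBang.{u} C)) (f : X ⊗ A ⟶ A) :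
    X ⟶ A :=
  Cokleisli.Hom.mk (fixOp C X.of A.of ((seely X.of A.of).hom ≫ f.of))

end FinScottL

/-! ### Conway operators on cartesian categories -/

open CartesianMonoidalCategory in
/-- Conway operators on a category with finite products. -/
structure IsCartesianConwayOperator {K : Type u} [Category.{v} K] [CartesianMonoidalCategory K]
    (Y : ∀ X A : K, (X ⊗ A ⟶ A) → (X ⟶ A)) : Prop where
  natural : ∀ {X Z A : K} (g : X ⟶ Z) (f : Z ⊗ A ⟶ A), Y X A (g ▷ A ≫ f) = g ≫ Y Z A f
  fixpoint : ∀ {X A : K} (f : X ⊗ A ⟶ A), Y X A f = lift (𝟙 X) (Y X A f) ≫ f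
  dinatural : ∀ {X A B : K} (f : X ⊗ B ⟶ A) (g : X ⊗ A ⟶ B),
    Y X A (lift (fst X A) g ≫ f) = lift (𝟙 X) (Y X B (lift (fst X B) f ≫ g)) ≫ f
  diagonal : ∀ {X A : K} (f : (X ⊗ A) ⊗ A ⟶ A),
    Y X A (Y (X ⊗ A) A f) = Y X A (lift (𝟙 (X ⊗ A)) (snd X A) ≫ f)

/-! ### The simply-typed `λY`-calculus and its interpretation -/

namespace LambdaY

/-- Simple types. -/
inductive Ty : Type
  | o : Ty
  | arr : Ty → Ty → Ty

/-- Variables of a context, as de Bruijn indices. -/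
inductive Var : List Ty → Ty → Type
  | zero {Γ : List Ty} {σ : Ty} : Var (σ :: Γ) σ
  | succ {Γ : List Ty} {σ τ : Ty} : Var Γ τ → Var (σ :: Γ) τ

/-- Simply-typed `λY`-terms in context, with constants `c : S` of type `ty c`. -/
inductive Tm {S : Type w} (ty : S → Ty) : List Ty → Ty → Type w
  | var {Γ : List Ty} {τ : Ty} : Var Γ τ → Tm ty Γ τ
  | const {Γ : List Ty} (c : S) : Tm ty Γ (ty c)
  | lam {Γ : List Ty} {σ τ : Ty} : Tm ty (σ :: Γ) τ → Tm ty Γ (.arr σ τ)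
  | app {Γ : List Ty} {σ τ : Ty} : Tm ty Γ (.arr σ τ) → Tm ty Γ σ → Tm ty Γ τ
  | fix {Γ : List Ty} (σ : Ty) : Tm ty Γ (.arr (.arr σ σ) σ)

section

variable {S : Type w} {ty : S → Ty}

/-- Extension of a renaming under a binder. -/
def liftRen {Γ Δ : List Ty} {σ : Ty} (r : ∀ τ, Var Γ τ → Var Δ τ) :
    ∀ τ, Var (σ :: Γ) τ → Var (σ :: Δ) τ
  | _, .zero => .zero
  | _, .succ x => .succ (r _ x)

def Tm.ren : ∀ {Γ Δ : List Ty} {τ : Ty}, (∀ τ, Var Γ τ → Var Δ τ) → Tm ty Γ τ → Tm ty Δ τ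
  | _, _, _, r, .var x => .var (r _ x)
  | _, _, _, _, .const c => .const c
  | _, _, _, r, .lam t => .lam (t.ren (liftRen r))
  | _, _, _, r, .app t s => .app (t.ren r) (s.ren r)
  | _, _, _, _, .fix σ => .fix σ

/-- Weakening. -/
def Tm.wk {Γ : List Ty} {σ τ : Ty} (t : Tm ty Γ τ) : Tm ty (σ :: Γ) τ :=
  t.ren fun _ x => .succ x

/-- Extension of a substitution under a binder. -/
def liftSub {Γ Δ : List Ty} {σ : Ty} (r : ∀ τ, Var Γ τ → Tm ty Δ τ) :
    ∀ τ, Var (σ :: Γ) τ → Tm ty (σ :: Δ) τ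
  | _, .zero => .var .zero
  | _, .succ x => (r _ x).wk

/-- Simultaneous capture-avoiding substitution. -/
def Tm.sub : ∀ {Γ Δ : List Ty} {τ : Ty}, (∀ τ, Var Γ τ → Tm ty Δ τ) → Tm ty Γ τ → Tm ty Δ τ
  | _, _, _, r, .var x => r _ x
  | _, _, _, _, .const c => .const c
  | _, _, _, r, .lam t => .lam (t.sub (liftSub r))
  | _, _, _, r, .app t s => .app (t.sub r) (s.sub r)
  | _, _, _, _, .fix σ => .fix σ

/-- The substitution of `s` for the last variable. -/
def single {Γ : List Ty} {σ : Ty} (s : Tm ty Γ σ) : ∀ τ, Var (σ :: Γ) τ → Tm ty Γ τ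
  | _, .zero => s
  | _, .succ x => .var x

/-- The equational theory of the `λY`-calculus: the congruence generated by `β`, `η` and
`Y M = M (Y M)`. -/
inductive Conv : ∀ {Γ : List Ty} {τ : Ty}, Tm ty Γ τ → Tm ty Γ τ → Prop
  | refl {Γ : List Ty} {τ : Ty} (t : Tm ty Γ τ) : Conv t t
  | symm {Γ : List Ty} {τ : Ty} {t s : Tm ty Γ τ} : Conv t s → Conv s t
  | trans {Γ : List Ty} {τ : Ty} {t s r : Tm ty Γ τ} : Conv t s → Conv s r → Conv t r
  | lam {Γ : List Ty} {σ τ : Ty} {t t' : Tm ty (σ :: Γ) τ} : Conv t t' → Conv (.lam t) (.lam t')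
  | app {Γ : List Ty} {σ τ : Ty} {t t' : Tm ty Γ (.arr σ τ)} {s s' : Tm ty Γ σ} :
      Conv t t' → Conv s s' → Conv (.app t s) (.app t' s')
  | beta {Γ : List Ty} {σ τ : Ty} (t : Tm ty (σ :: Γ) τ) (s : Tm ty Γ σ) :
      Conv (.app (.lam t) s) (t.sub (single s))
  | eta {Γ : List Ty} {σ τ : Ty} (t : Tm ty Γ (.arr σ τ)) :
      Conv (.lam (.app t.wk (.var .zero))) t
  | delta {Γ : List Ty} {σ : Ty} (t : Tm ty Γ (.arr σ σ)) :
      Conv (.app (.fix σ) t) (.app t (.app (.fix σ) t))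

end

section

variable {K : Type u} [Category.{v} K] [CartesianMonoidalCategory K] [MonoidalClosed K]

open CartesianMonoidalCategory

/-- The interpretation of simple types, given the interpretation of the ground type. -/
def Ty.sem (O : K) : Ty → K
  | .o => O
  | .arr σ τ => (ihom (Ty.sem O σ)).obj (Ty.sem O τ)

/-- Contexts are interpreted as products. -/
def ctxSem (O : K) : List Ty → K
  | [] => 𝟙_ K
  | σ :: Γ => σ.sem O ⊗ ctxSem O Γ

/-- Variables are interpreted as projections. -/
def Var.sem (O : K) : ∀ {Γ : List Ty} {τ : Ty}, Var Γ τ → (ctxSem O Γ ⟶ τ.sem O)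
  | _, _, .zero => fst _ _
  | _, _, .succ x => snd _ _ ≫ Var.sem O x

/-- The internal fixpoint combinator `(A ⇒ A) ⇒ A` at a parameter `X`: the currying of `Y` applied
to evaluation. -/
def fixSem (Y : ∀ X A : K, (X ⊗ A ⟶ A) → (X ⟶ A)) (X A : K) :
    X ⟶ (ihom ((ihom A).obj A)).obj A :=
  MonoidalClosed.curry (Y ((ihom A).obj A ⊗ X) A
    (lift (snd _ _) (fst _ _ ≫ fst _ _) ≫ (ihom.ev A).app A))

/-- The standard interpretation of `λY`-terms in a cartesian closed category with an operator `Y`,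
given the interpretations of the ground type and of the constants. -/
def Tm.sem (Y : ∀ X A : K, (X ⊗ A ⟶ A) → (X ⟶ A)) (O : K) {S : Type w} {ty : S → Ty}
    (κ : ∀ c, 𝟙_ K ⟶ (ty c).sem O) :
    ∀ {Γ : List Ty} {τ : Ty}, Tm ty Γ τ → (ctxSem O Γ ⟶ τ.sem O)
  | _, _, .var x => x.sem O
  | _, _, .const c => toUnit _ ≫ κ c
  | _, _, .lam t => MonoidalClosed.curry (t.sem Y O κ)
  | _, _, .app t s => lift (s.sem Y O κ) (t.sem Y O κ) ≫ (ihom.ev _).app _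
  | _, _, .fix σ => fixSem Y _ (σ.sem O)

/-- A cartesian closed category with an operator `Y` is a model of the `λY`-calculus when its
interpretation identifies convertible terms. -/
def IsModel (Y : ∀ X A : K, (X ⊗ A ⟶ A) → (X ⟶ A)) : Prop :=
  ∀ (O : K) {S : Type w} (ty : S → Ty) (κ : ∀ c, 𝟙_ K ⟶ (ty c).sem O) {Γ : List Ty} {τ : Ty}
    (t s : Tm ty Γ τ), Conv t s → t.sem Y O κ = s.sem Y O κ

end

end LambdaY

/-!
`fixOp C X A R` relates `s` to `a` exactly when the player wins a parity game from `a`: at the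
position `b`, the player chooses a finite set `v` of coloured positions such that `R` relates
`(s', v)` to `b`, where `s'` is `s` relativised to the colours read so far, and the opponent chooses
an element of `v`. Run-trees are strategies, and the unfolding of a strategy is a run-tree.

The parity condition depends only on the eventual upper bounds of the sequence of colours, so it
does not change when the moves of a play are grouped into blocks, each with the maximum of its
colours. Hence the game in which a whole block is played at once, by means of a winning strategy of
the block, has the same winner as the original game. The Conway identities are comparisons of games:
naturality and the fixpoint identity by relabelling and by playing the first move, dinaturality and
the diagonal identity by grouping moves into blocks.

The identities are transported to the Kleisli category along the Seely isomorphisms. The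
interpretation of the `λY`-calculus is compatible with substitution by naturality, and with the
unfolding of `Y` by the fixpoint identity.
-/

/-! ### Eventual bounds of sequences -/

section EventualBounds

open Filter Finset

variable {K : Type*}

/-- The elements which bound all but finitely many terms of a sequence. A least one, if it exists,
is the limit superior of the sequence. -/
def eventualBounds [LE K] (c : ℕ → K) : Set K := {x | ∀ᶠ n in atTop, c n ≤ x}

theorem eventualBounds_comp_add [LE K] (c : ℕ → K) (k : ℕ) :
    eventualBounds (fun n => c (n + k)) = eventualBounds c := by
  ext x
  change (∀ᶠ n in atTop, c (n + k) ≤ x) ↔ ∀ᶠ n in atTop, c n ≤ x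
  conv_rhs => rw [← map_add_atTop_eq_nat k, eventually_map]

theorem exists_mem_Ico_of_strictMono {t : ℕ → ℕ} (ht : StrictMono t) {N n : ℕ} (hn : t N ≤ n) :
    ∃ k ≥ N, t k ≤ n ∧ n < t (k + 1) := by
  have unbounded : ¬ BddAbove (t '' Set.Ici N) := not_bddAbove_iff.2 fun m =>
    ⟨_, Set.mem_image_of_mem t (le_max_left N (m + 1)), (le_max_right N (m + 1)).trans ht.le_apply⟩
  have hmem : n ∈ ⋃ k ∈ Set.Ici N, Set.Ico (t k) (t (Order.succ k)) := by
    rwa [biUnion_Ici_Ico_map_succ (fun _ h => ht.monotone h) unbounded]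
  simp only [Set.mem_iUnion₂] at hmem
  obtain ⟨k, hk, hnk⟩ := hmem
  exact ⟨k, hk, hnk⟩

theorem eventualBounds_sup_Ico [SemilatticeSup K] [OrderBot K] (d : ℕ → K) {t : ℕ → ℕ}
    (ht : StrictMono t) :
    eventualBounds (fun k => (Ico (t k) (t (k + 1))).sup d) = eventualBounds d := by
  ext x
  simp only [eventualBounds, Set.mem_ofPred_eq, eventually_atTop, Finset.sup_le_iff, mem_Ico]
  constructor
  · rintro ⟨N, hN⟩
    refine ⟨t N, fun n hn => ?_⟩
    obtain ⟨k, hk, hnk⟩ := exists_mem_Ico_of_strictMono ht hn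
    exact hN k hk n hnk
  · rintro ⟨N, hN⟩
    exact ⟨N, fun k hk n hn => hN n ((hk.trans ht.le_apply).trans hn.1)⟩

theorem isLeast_eventualBounds_iff [LinearOrder K] [Finite K] {c : ℕ → K} {k : K} :
    IsLeast (eventualBounds c) k ↔
      (∃ᶠ n in atTop, c n = k) ∧ ∀ d, (∃ᶠ n in atTop, c n = d) → d ≤ k := by
  have bound_of_frequent_le (h : ∀ d, (∃ᶠ n in atTop, c n = d) → d ≤ k) :
      k ∈ eventualBounds c := by
    have : ∀ᶠ n in atTop, ∀ d, ¬ d ≤ k → c n ≠ d :=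
      eventually_all.2 fun d => eventually_imp_distrib_left.2 fun hd =>
        not_frequently.1 (mt (h d) hd)
    exact this.mono fun n hn => by_contra fun h => hn _ h rfl
  have le_of_frequent {d x : K} (hd : ∃ᶠ n in atTop, c n = d) (hx : x ∈ eventualBounds c) :
      d ≤ x := by
    obtain ⟨n, rfl, hn⟩ := (hd.and_eventually hx).exists
    exact hn
  constructor
  · rintro ⟨hk, hmin⟩
    refine ⟨fun hne => ?_, fun d hd => le_of_frequent hd hk⟩
    have hlt : ∀ᶠ n in atTop, c n < k := (hk.and hne).mono fun n hn => hn.1.lt_of_ne hn.2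
    obtain ⟨m, hm⟩ := hlt.exists
    obtain ⟨x, hxk, hx⟩ := Set.exists_max_image (Set.Iio k) id (Set.toFinite _) ⟨c m, hm⟩
    exact hxk.not_ge (hmin (hlt.mono fun n hn => hx _ hn))
  · rintro ⟨hk, hmax⟩
    exact ⟨bound_of_frequent_le hmax, fun x hx => le_of_frequent hk hx⟩

theorem sup_Ico_succ [SemilatticeSup K] [OrderBot K] {a b : ℕ} (hab : a ≤ b) (d : ℕ → K) :
    (Ico a (b + 1)).sup d = (Ico a b).sup d ⊔ d b := by
  rw [← insert_Ico_right_eq_Ico_add_one hab, sup_insert, sup_comm]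

end EventualBounds

/-! ### Graphs with coloured edges -/

namespace ColouredGraph

open Finset

variable {K : Type} {Q : Type u} {Ω : Set K → Prop} {E : Q → K → Q → Prop}

section Sound

/-- The disjoint union of a family of coloured graphs. -/
inductive SigmaEdge {I : Type u} {Q : I → Type u} (E : ∀ i, Q i → K → Q i → Prop) :
    (Σ i, Q i) → K → (Σ i, Q i) → Prop
  | mk {i : I} {q : Q i} {c : K} {q' : Q i} : E i q c q' → SigmaEdge E ⟨i, q⟩ c ⟨i, q'⟩

theorem SigmaEdge.exists_eq {I : Type u} {Q : I → Type u} {E : ∀ i, Q i → K → Q i → Prop}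
    {i : I} {q : Q i} {c : K} {y : Σ i, Q i} (h : SigmaEdge E ⟨i, q⟩ c y) :
    ∃ q', y = ⟨i, q'⟩ ∧ E i q c q' := by
  cases h with
  | mk h => exact ⟨_, rfl, h⟩

variable [LE K]

/-- All infinite paths of a graph with coloured edges satisfy the objective `Ω`, which is a
condition on the eventual bounds of the sequence of colours. -/
def Sound (Ω : Set K → Prop) (E : Q → K → Q → Prop) : Prop :=
  ∀ (q : ℕ → Q) (c : ℕ → K), (∀ n, E (q n) (c n) (q (n + 1))) → Ω (eventualBounds c)

theorem Sound.of_eventually (hE : Sound Ω E) {q : ℕ → Q} {c : ℕ → K} (N : ℕ)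
    (h : ∀ n ≥ N, E (q n) (c n) (q (n + 1))) : Ω (eventualBounds c) := by
  rw [← eventualBounds_comp_add c N]
  refine hE (fun n => q (n + N)) _ fun n => ?_
  rw [Nat.add_right_comm]
  exact h _ (Nat.le_add_left N n)

theorem Sound.sigma {I : Type u} {Q : I → Type u} {E : ∀ i, Q i → K → Q i → Prop}
    (h : ∀ i, Sound Ω (E i)) : Sound Ω (SigmaEdge E) := by
  intro x c hx
  have stays : ∀ n, ∃ r, x n = ⟨(x 0).1, r⟩ := fun n => by
    induction n with
    | zero => exact ⟨_, rfl⟩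
    | succ n ih =>
      obtain ⟨r, hr⟩ := ih
      obtain ⟨r', hr', -⟩ := (hr ▸ hx n).exists_eq
      exact ⟨r', hr'⟩
  choose r hr using stays
  refine h _ r c fun n => ?_
  obtain ⟨r', hr', hE⟩ := (hr n ▸ hx n).exists_eq
  rw [hr (n + 1)] at hr'
  cases hr'
  exact hE

end Sound

variable [SemilatticeSup K] [OrderBot K]

/-- `Path E q c q'`: there is a path from `q` to `q'` whose colours have the supremum `c`. -/
inductive Path (E : Q → K → Q → Prop) (q : Q) : K → Q → Prop
  | nil : Path E q ⊥ q
  | snoc {c d : K} {r r' : Q} : Path E q c r → E r d r' → Path E q (c ⊔ d) r'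

/-- A path of `E`, followed by an edge of `F`, as a single edge. -/
def PathThen (E F : Q → K → Q → Prop) (q : Q) (c : K) (q' : Q) : Prop :=
  ∃ a r d, Path E q a r ∧ F r d q' ∧ c = a ⊔ d

theorem PathThen.exists_walk {q q' : Q} {c : K} (h : PathThen E E q c q') :
    ∃ (n : ℕ) (p : ℕ → Q) (d : ℕ → K), p 0 = q ∧ p (n + 1) = q' ∧
      (∀ i ≤ n, E (p i) (d i) (p (i + 1))) ∧ c = (range (n + 1)).sup d := by
  obtain ⟨a, r, e, hpath, hedge, rfl⟩ := h
  induction hpath generalizing e q' with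
  | nil =>
    refine ⟨0, fun i => Nat.casesOn i q fun _ => q', fun _ => e, rfl, rfl, fun i hi => ?_, by simp⟩
    rwa [Nat.le_zero.1 hi]
  | snoc _ hE ih =>
    obtain ⟨n, p, d, hp₀, rfl, hp, hsup⟩ := ih _ hE
    refine ⟨n + 1, Function.update p (n + 2) q', Function.update d (n + 1) e, ?_, ?_,
      fun i hi => ?_, ?_⟩
    · rw [Function.update_of_ne (Nat.succ_ne_zero _).symm, hp₀]
    · rw [Function.update_self]
    · rw [Function.update_of_ne (by omega)]
      obtain rfl | hi := hi.eq_or_lt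
      · simpa only [Function.update_self] using hedge
      · rw [Function.update_of_ne hi.ne, Function.update_of_ne (by omega)]
        exact hp i (Nat.lt_succ_iff.1 hi)
    · rw [hsup, range_add_one (n := n + 1), sup_insert, Function.update_self, sup_comm]
      congr 1
      exact sup_congr rfl fun i hi => (Function.update_of_ne (mem_range.1 hi).ne _ _).symm

theorem exists_concat {len : ℕ → ℕ} {p : ℕ → ℕ → Q} {d : ℕ → ℕ → K}
    (hp : ∀ k, ∀ i ≤ len k, E (p k i) (d k i) (p k (i + 1)))
    (hglue : ∀ k, p k (len k + 1) = p (k + 1) 0) :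
    ∃ (x : ℕ → Q) (e : ℕ → K) (t : ℕ → ℕ), StrictMono t ∧
      (∀ n, E (x n) (e n) (x (n + 1))) ∧
      ∀ k, (Ico (t k) (t (k + 1))).sup e = (range (len k + 1)).sup (d k) := by
  let t (k : ℕ) : ℕ := ∑ j ∈ range k, (len j + 1)
  have t_succ (k : ℕ) : t (k + 1) = t k + (len k + 1) := sum_range_succ ..
  have ht : StrictMono t := strictMono_nat_of_lt_succ fun k => by rw [t_succ]; omega
  choose b _ hb hb' using fun n => exists_mem_Ico_of_strictMono ht (N := 0) (Nat.zero_le n)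
  have block_unique {k n : ℕ} (h : t k ≤ n) (h' : n < t (k + 1)) : b n = k :=
    le_antisymm (Nat.lt_succ_iff.1 (ht.lt_iff_lt.1 ((hb n).trans_lt h')))
      (Nat.lt_succ_iff.1 (ht.lt_iff_lt.1 (h.trans_lt (hb' n))))
  let x (n : ℕ) : Q := p (b n) (n - t (b n))
  have x_eq {k n : ℕ} (h : t k ≤ n) (h' : n ≤ t (k + 1)) : x n = p k (n - t k) := by
    obtain rfl | h' := h'.eq_or_lt
    · have : b (t (k + 1)) = k + 1 := block_unique le_rfl (ht (Nat.lt_succ_self _))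
      simp only [x, this, Nat.sub_self]
      rw [← hglue, t_succ, Nat.add_sub_cancel_left]
    · simp only [x, block_unique h h']
  refine ⟨x, fun n => d (b n) (n - t (b n)), t, ht, fun n => ?_, fun k => ?_⟩
  · have hn := t_succ (b n) ▸ hb' n
    rw [x_eq ((hb n).trans n.le_succ) (hb' n), Nat.succ_sub (hb n)]
    exact hp _ _ (by omega)
  · have : Ico (t k) (t (k + 1)) = (Ico 0 (len k + 1)).image (t k + ·) := by
      rw [image_add_left_Ico, add_zero, t_succ]
    rw [this, sup_image, range_eq_Ico]
    refine sup_congr rfl fun i hi => ?_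
    have := mem_Ico.1 hi
    simp [block_unique (k := k) (n := t k + i) (by omega) (by rw [t_succ]; omega)]

theorem Sound.pathThen (hE : Sound Ω E) : Sound Ω (PathThen E E) := by
  intro q c h
  choose len p d hstart hend hstep hsup using fun k => (h k).exists_walk
  obtain ⟨x, e, t, ht, hx, he⟩ := exists_concat hstep fun k => (hend k).trans (hstart _).symm
  rw [funext fun k => (hsup k).trans (he k).symm, eventualBounds_sup_Ico e ht]
  exact hE x e hx

theorem Path.of_Ico {x : ℕ → Q} {d : ℕ → K} {a b : ℕ} (hab : a ≤ b)
    (h : ∀ n, a ≤ n → n < b → E (x n) (d n) (x (n + 1))) :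
    Path E (x a) ((Ico a b).sup d) (x b) := by
  induction b, hab using Nat.le_induction with
  | base => simpa using Path.nil
  | succ b hab ih =>
    rw [sup_Ico_succ hab]
    exact (ih fun n hn hn' => h n hn (hn'.trans b.lt_succ_self)).snoc (h b hab b.lt_succ_self)

/-- Either the edges of `F` occur finitely often on an infinite path, or they cut it into
blocks. -/
theorem Sound.union {F : Q → K → Q → Prop} (hE : Sound Ω E) (hF : Sound Ω (PathThen E F)) :
    Sound Ω fun q c q' => F q c q' ∨ E q c q' := by
  intro x d hx
  let cut (n : ℕ) : Prop := F (x n) (d n) (x (n + 1))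
  have no_cut (n : ℕ) (hn : ¬ cut n) : E (x n) (d n) (x (n + 1)) := (hx n).resolve_left hn
  by_cases hinf : {n | cut n}.Infinite
  · let t (k : ℕ) : ℕ := Nat.nth cut k + 1
    have ht : StrictMono t := fun _ _ h => Nat.succ_lt_succ (Nat.nth_strictMono hinf h)
    rw [← eventualBounds_sup_Ico d ht]
    refine hF (fun k => x (t k)) _ fun k => ⟨_, _, _, Path.of_Ico (b := Nat.nth cut (k + 1))
      (Nat.nth_strictMono hinf k.lt_succ_self) fun n hn hn' => no_cut n fun hcut => ?_,
      Nat.nth_mem_of_infinite hinf _, sup_Ico_succ (Nat.nth_strictMono hinf k.lt_succ_self) d⟩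
    exact (Nat.lt_of_succ_le hn).not_ge (Nat.le_nth_of_lt_nth_succ hn' hcut)
  · obtain ⟨N, hN⟩ := (Set.not_infinite.1 hinf).bddAbove
    exact hE.of_eventually (N + 1) fun n hn => no_cut n fun hcut => (hN hcut).not_gt hn

end ColouredGraph

/-! ### Games with coloured moves -/

/-- A game against an opponent: at the position `p`, the player chooses a set `V` of pairs of a
colour and a position such that `move p V`, and the opponent chooses an element of `V`. -/
structure ColouredGame (K : Type) (P : Type u) where
  move : P → Set (K × P) → Prop
  mono : ∀ ⦃p V V'⦄, V ⊆ V' → move p V → move p V'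

namespace ColouredGame

open ColouredGraph

variable {K : Type} {P P' : Type u}

section Win

variable [LE K] {Ω : Set K → Prop} {G : ColouredGame K P}

/-- A strategy, with an arbitrary memory, which wins all infinite plays with respect to the
objective `Ω`. -/
structure Strategy (Ω : Set K → Prop) (G : ColouredGame K P) where
  State : Type u
  pos : State → P
  edge : State → K → State → Prop
  legal : ∀ q, G.move (pos q) {m | ∃ q', edge q m.1 q' ∧ pos q' = m.2}
  sound : Sound Ω edge

/-- The winning positions of a game. -/
def Win (Ω : Set K → Prop) (G : ColouredGame K P) (p : P) : Prop :=
  ∃ (σ : Strategy Ω G) (q : σ.State), σ.pos q = p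

theorem Win.of_root {Q : Type u} {pos : Q → P} {E : Q → K → Q → Prop} (q₀ : Q)
    (legal : ∀ q, G.move (pos q) {m | ∃ q', E q m.1 q' ∧ pos q' = m.2})
    (sound : ∀ (q : ℕ → Q) (c : ℕ → K), q 0 = q₀ → (∀ n, E (q n) (c n) (q (n + 1))) →
      Ω (eventualBounds c)) : Win Ω G (pos q₀) := by
  let Good (q₁ : Q) : Prop := ∀ (q : ℕ → Q) (c : ℕ → K), q 0 = q₁ →
    (∀ n, E (q n) (c n) (q (n + 1))) → Ω (eventualBounds c)
  have good_of_edge {q c q'} (hq : Good q) (hE : E q c q') : Good q' := by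
    intro x d hx hEx
    have := hq (fun n => Nat.casesOn n q x) (fun n => Nat.casesOn n c d) rfl fun n => by
      cases n with
      | zero => exact (congrArg (E q c) hx).mpr hE
      | succ n => exact hEx n
    rwa [← eventualBounds_comp_add _ 1] at this
  refine ⟨⟨{q // Good q}, fun q => pos q.1, fun q c q' => E q.1 c q'.1,
    fun q => G.mono ?_ (legal q.1), fun q c h => (q 0).2 (fun n => (q n).1) c rfl h⟩,
    ⟨q₀, sound⟩, rfl⟩
  rintro m ⟨q', hE, hm⟩
  exact ⟨⟨q', good_of_edge q.2 hE⟩, hE, hm⟩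

theorem Win.simulate {G' : ColouredGame K P'} (S : P → P' → Prop)
    (h : ∀ p p' V, S p p' → G.move p V → G'.move p' {m | ∃ y, (m.1, y) ∈ V ∧ S y m.2})
    {p : P} {p' : P'} (hw : Win Ω G p) (hp : S p p') : Win Ω G' p' := by
  obtain ⟨σ, q₀, rfl⟩ := hw
  refine ⟨⟨{x : σ.State × P' // S (σ.pos x.1) x.2}, fun x => x.1.2,
    fun x c y => σ.edge x.1.1 c y.1.1, fun x => G'.mono ?_ (h _ _ _ x.2 (σ.legal x.1.1)),
    fun x c hx => σ.sound (fun n => (x n).1.1) c hx⟩, ⟨(q₀, p'), hp⟩, rfl⟩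
  rintro ⟨c, p'⟩ ⟨_, ⟨q, hq, rfl⟩, hS⟩
  exact ⟨⟨(q, p'), hS⟩, hq, rfl⟩

theorem Win.mono {G' : ColouredGame K P} (h : ∀ p V, G.move p V → G'.move p V) {p : P}
    (hw : Win Ω G p) : Win Ω G' p :=
  hw.simulate Eq (fun p _ V hp hV => hp ▸ G'.mono (fun m hm => ⟨m.2, hm, rfl⟩) (h p V hV)) rfl

theorem win_iff_of_map {G' : ColouredGame K P'} (φ : P → P')
    (h : ∀ p V, G.move p {m | (m.1, φ m.2) ∈ V} ↔ G'.move (φ p) V) {p : P} :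
    Win Ω G p ↔ Win Ω G' (φ p) := by
  constructor
  · refine fun hw => hw.simulate (fun p p' => φ p = p') ?_ rfl
    rintro p _ V rfl hV
    exact (h p _).1 (G.mono (fun m hm => ⟨m.2, hm, rfl⟩) hV)
  · refine fun hw => hw.simulate (fun p' p => φ p = p') ?_ rfl
    rintro _ p V rfl hV
    exact G.mono (fun m hm => ⟨_, hm, rfl⟩) ((h p V).2 hV)

theorem Win.move {p : P} (hw : Win Ω G p) : G.move p {m | Win Ω G m.2} := by
  obtain ⟨σ, q, rfl⟩ := hw
  refine G.mono ?_ (σ.legal q)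
  rintro m ⟨q', -, hq'⟩
  exact ⟨σ, q', hq'⟩

theorem Win.of_move {p : P} (h : G.move p {m | Win Ω G m.2}) : Win Ω G p := by
  choose σ r hr using fun p : {p // Win Ω G p} => p.2
  let State := Option (Σ p, (σ p).State)
  let edge (x : State) (c : K) (y : State) : Prop :=
    ∃ z, y = some z ∧ ∀ w, x = some w → SigmaEdge (fun p => (σ p).edge) w c z
  refine ⟨⟨State, fun x => x.elim p fun y => (σ y.1).pos y.2, edge, ?_, fun x c hx => ?_⟩,
    none, rfl⟩
  · rintro (_ | ⟨p', q⟩)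
    · refine G.mono ?_ h
      rintro ⟨c, p'⟩ hp'
      exact ⟨some ⟨⟨p', hp'⟩, r _⟩, ⟨_, rfl, fun w hw => by cases hw⟩, hr ⟨p', hp'⟩⟩
    · refine G.mono ?_ ((σ p').legal q)
      rintro ⟨c, _⟩ ⟨q', hq', rfl⟩
      refine ⟨some ⟨p', q'⟩, ⟨_, rfl, fun w hw => ?_⟩, rfl⟩
      obtain rfl := Option.some.inj hw
      exact ⟨hq'⟩
  · choose z hz hE using hx
    rw [← eventualBounds_comp_add c 1]
    exact Sound.sigma (fun p => (σ p).sound) z _ fun n => hE _ _ (hz n)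

theorem win_iff {p : P} : Win Ω G p ↔ G.move p {m | Win Ω G m.2} := ⟨Win.move, Win.of_move⟩

end Win

end ColouredGame

/-! ### Regrouping the moves of a game -/

/-- A game where the player chooses two sets of pairs of a colour and a position, and the opponent
chooses an element of one of them. The elements of the first set are called inner moves, those of
the second set outer moves. -/
structure SplitGame (K : Type) (P : Type u) where
  move : P → Set (K × P) → Set (K × P) → Prop
  mono : ∀ ⦃p V V' W W'⦄, V ⊆ V' → W ⊆ W' → move p V W → move p V' W'

namespace SplitGame

open ColouredGame ColouredGraph

variable {K : Type} [SemilatticeSup K] {P : Type u} {Ω : Set K → Prop}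

/-- The game where no distinction is made between inner and outer moves. -/
def merged (G : SplitGame K P) : ColouredGame K P where
  move p V := G.move p V V
  mono _ _ _ h := G.mono h h

/-- The game which ends with the first outer move. The pair of the supremum of the colours which
occurred and of the last position has then to be in `W`. -/
def innerGame (G : SplitGame K P) (W : Set (K × P)) : ColouredGame K (K × P) where
  move x V := G.move x.2 {m | (m.1, (x.1 ⊔ m.1, m.2)) ∈ V} {m | (x.1 ⊔ m.1, m.2) ∈ W}
  mono _ _ _ h := G.mono (fun _ hm => h hm) subset_rfl

section Expand

variable {G : SplitGame K P} {I : Type u} {W : I → Set (K × P)}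
  (τ : ∀ i, Strategy Ω (G.innerGame (W i)))

/-- The inner moves when each vertex `i` of a graph is expanded to a strategy `τ i` of an inner
game: the play goes on in the same inner game, which keeps track of the supremum of the colours. -/
def innerEdge (x : Σ i, (τ i).State) (d : K) (y : Σ i, (τ i).State) : Prop :=
  SigmaEdge (fun i => (τ i).edge) x d y ∧ ((τ y.1).pos y.2).1 = ((τ x.1).pos x.2).1 ⊔ d

/-- The outer moves when each vertex `i` of the graph `F` is expanded to a strategy `τ i` of an
inner game: the play follows an edge of `F` to `j`, and enters the inner game at `r j`. -/
def outerEdge (F : I → K → I → Prop) (r : ∀ i, (τ i).State) (x : Σ i, (τ i).State) (d : K)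
    (y : Σ i, (τ i).State) : Prop :=
  F x.1 (((τ x.1).pos x.2).1 ⊔ d) y.1 ∧ y.2 = r y.1

theorem sound_innerEdge : Sound Ω (innerEdge τ) := fun x c hx =>
  Sound.sigma (fun i => (τ i).sound) x c fun n => (hx n).1

variable [OrderBot K]

theorem path_innerEdge {x z : Σ i, (τ i).State} {a : K} (h : Path (innerEdge τ) x a z) :
    z.1 = x.1 ∧ ((τ z.1).pos z.2).1 = ((τ x.1).pos x.2).1 ⊔ a := by
  induction h with
  | nil => exact ⟨rfl, (sup_bot_eq _).symm⟩
  | snoc _ hE ih =>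
    obtain ⟨⟨hE⟩, hcol⟩ := hE
    exact ⟨ih.1, by rw [hcol, ih.2, sup_assoc]⟩

theorem sound_outerEdge {F : I → K → I → Prop} {r : ∀ i, (τ i).State} (hF : Sound Ω F)
    (hr : ∀ i, ((τ i).pos (r i)).1 = ⊥) :
    Sound Ω (PathThen (innerEdge τ) (outerEdge τ F r)) := by
  intro x c hx
  have starts (n : ℕ) : ((τ (x (n + 1)).1).pos (x (n + 1)).2).1 = ⊥ := by
    obtain ⟨a, z, d, -, ⟨-, hz⟩, -⟩ := hx n
    rw [hz, hr]
  refine hF.of_eventually (q := fun n => (x n).1) 1 fun n hn => ?_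
  obtain ⟨a, z, d, hpath, ⟨hedge, -⟩, hc⟩ := hx n
  obtain ⟨hz, hcol⟩ := path_innerEdge τ hpath
  obtain ⟨m, rfl⟩ := Nat.exists_eq_add_of_le' hn
  rwa [hcol, starts, bot_sup_eq, ← hc, hz] at hedge

end Expand

variable [OrderBot K]

/-- The game where a play up to the first outer move is a single move. -/
def accelerated (Ω : Set K → Prop) (G : SplitGame K P) : ColouredGame K P where
  move p W := Win Ω (G.innerGame W) (⊥, p)
  mono _ _ _ h := Win.mono fun _ _ => G.mono subset_rfl (Set.preimage_mono h)

variable {G : SplitGame K P}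

theorem win_innerGame_pathThen (σ : Strategy Ω G.merged) (q : σ.State) :
    Win Ω (G.innerGame {m | ∃ q', PathThen σ.edge σ.edge q m.1 q' ∧ σ.pos q' = m.2})
      (⊥, σ.pos q) := by
  refine ⟨⟨{x : K × σ.State // Path σ.edge q x.1 x.2}, fun x => (x.1.1, σ.pos x.1.2),
    fun x d y => σ.edge x.1.2 d y.1.2 ∧ y.1.1 = x.1.1 ⊔ d, fun x => ?_,
    fun x c hx => σ.sound (fun n => (x n).1.2) c fun n => (hx n).1⟩, ⟨(⊥, q), Path.nil⟩, rfl⟩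
  refine G.mono ?_ ?_ (σ.legal x.1.2)
  · rintro ⟨d, _⟩ ⟨q', hq', rfl⟩
    exact ⟨⟨(x.1.1 ⊔ d, q'), x.2.snoc hq'⟩, ⟨hq', rfl⟩, rfl⟩
  · rintro ⟨d, _⟩ ⟨q', hq', rfl⟩
    exact ⟨q', ⟨x.1.1, x.1.2, d, x.2, hq', rfl⟩, rfl⟩

theorem win_accelerated_of_merged {p : P} (h : Win Ω G.merged p) :
    Win Ω (G.accelerated Ω) p := by
  obtain ⟨σ, q₀, rfl⟩ := h
  exact ⟨⟨σ.State, σ.pos, PathThen σ.edge σ.edge, win_innerGame_pathThen σ, σ.sound.pathThen⟩,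
    q₀, rfl⟩

theorem win_merged_of_accelerated {p : P} (h : Win Ω (G.accelerated Ω) p) :
    Win Ω G.merged p := by
  obtain ⟨σ, q₀, rfl⟩ := h
  have legal (q : σ.State) : Win Ω (G.innerGame _) (⊥, σ.pos q) := σ.legal q
  choose τ r hr using legal
  refine ⟨⟨Σ q, (τ q).State, fun x => ((τ x.1).pos x.2).2,
    fun x d y => outerEdge τ σ.edge r x d y ∨ innerEdge τ x d y, fun ⟨q, x⟩ => ?_,
    (sound_innerEdge τ).union (sound_outerEdge τ σ.sound fun q => congrArg Prod.fst (hr q))⟩,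
    ⟨q₀, r q₀⟩, congrArg Prod.snd (hr q₀)⟩
  refine G.mono ?_ ?_ ((τ q).legal x)
  · rintro ⟨d, p'⟩ ⟨x', hx', h⟩
    exact ⟨⟨q, x'⟩, Or.inr ⟨⟨hx'⟩, congrArg Prod.fst h⟩, (congrArg Prod.snd h :)⟩
  · rintro ⟨d, _⟩ ⟨q', hq', rfl⟩
    exact ⟨⟨q', r q'⟩, Or.inl ⟨hq', rfl⟩, (congrArg Prod.snd (hr q') :)⟩

theorem win_accelerated_iff {p : P} : Win Ω (G.accelerated Ω) p ↔ Win Ω G.merged p :=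
  ⟨win_merged_of_accelerated, win_accelerated_of_merged⟩

end SplitGame

namespace FinScottL

/-! ### The game of a morphism -/

section Bang

theorem Bang.le_of_subset {α : Type u} [Preorder α] {s t : Bang α} (h : ∀ a ∈ s, a ∈ t) : s ≤ t :=
  fun a ha => ⟨a, h a ha, le_rfl⟩

variable {C : Finset ℕ} {α : Type u} [Preorder α] [Finite α]

theorem Bang.mem_unpaint {c : Col C} {s : Bang (Box C α)} {z : Box C α} :
    z ∈ Bang.unpaint c s ↔ ∃ x ∈ s, x.col = max c z.col ∧ z.val ≤ x.val := Bang.mem_ofSet _ _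

theorem Bang.le_unpaint_iff {c : Col C} {s t : Bang (Box C α)} :
    s ≤ Bang.unpaint c t ↔ Bang.Paint c s t :=
  ⟨fun h => (Bang.unpaint_paint c t).mono h le_rfl, fun h => Bang.le_of_subset fun _ => h.mem⟩

theorem Bang.unpaint_unpaint (c d : Col C) (s : Bang (Box C α)) :
    Bang.unpaint d (Bang.unpaint c s) = Bang.unpaint (max c d) s := by
  refine Bang.ext fun z => ?_
  simp only [Bang.mem_unpaint]
  constructor
  · rintro ⟨x, ⟨y, hy, hyx, hxy⟩, hxz, hzx⟩
    exact ⟨y, hy, by rw [hyx, hxz, max_assoc], hzx.trans hxy⟩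
  · rintro ⟨y, hy, hyz, hzy⟩
    exact ⟨⟨max d z.col, z.val⟩, ⟨y, hy, by rw [hyz, max_assoc], hzy⟩, rfl, le_rfl⟩

theorem Bang.unpaint_mono (c : Col C) {s t : Bang (Box C α)} (h : s ≤ t) :
    Bang.unpaint c s ≤ Bang.unpaint c t :=
  Bang.le_unpaint_iff.2 ((Bang.unpaint_paint c s).mono le_rfl h)

theorem Bang.unpaint_bot_le (s : Bang (Box C α)) : Bang.unpaint ⊥ s ≤ s :=
  Bang.paint_bot.1 (Bang.unpaint_paint _ _)

end Bang

section Game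

open ColouredGame

variable {C : Finset ℕ} {X A : FinScottL.{u}}

/-- The elements of `!□A` which lead from the parameter `s` to an element of `V`: a player who
chooses `y` with the colour `c` can use the elements of `s` only through the colour `c`. -/
noncomputable def choices (s : Bang (Box C X)) (V : Set (Col C × (Bang (Box C X) × A))) :
    Bang (Box C A) :=
  Bang.ofSet {y | (y.col, (Bang.unpaint y.col s, y.val)) ∈ V}

theorem mem_choices {s : Bang (Box C X)} {V : Set (Col C × (Bang (Box C X) × A))}
    {y : Box C A} : y ∈ choices s V ↔ (y.col, (Bang.unpaint y.col s, y.val)) ∈ V :=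
  Bang.mem_ofSet _ _

theorem choices_mono (s : Bang (Box C X)) {V V' : Set (Col C × (Bang (Box C X) × A))}
    (h : V ⊆ V') : choices s V ≤ choices s V' :=
  Bang.le_of_subset fun _ hy => mem_choices.2 (h (mem_choices.1 hy))

/-- The game of `R`: at the position `(s, a)`, the player chooses an element of `!□A` which `R`
relates together with `s` to `a`, and the opponent chooses one of its elements. -/
def runGame (R : colObj C X ⊗ colObj C A ⟶ A) :
    ColouredGame (Col C) (Bang (Box C X) × A) where
  move p V := R.rel (p.1, choices p.1 V) p.2
  mono _ _ _ h hR := down R hR ⟨le_rfl, choices_mono _ h⟩ le_rfl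

variable {R : colObj C X ⊗ colObj C A ⟶ A}

theorem runGame_move {s : Bang (Box C X)} {v : Bang (Box C A)} {a : A}
    {V : Set (Col C × (Bang (Box C X) × A))} (hv : R.rel (s, v) a)
    (h : ∀ y ∈ v, (y.col, (Bang.unpaint y.col s, y.val)) ∈ V) : (runGame R).move (s, a) V :=
  down R hv ⟨le_rfl, Bang.le_of_subset fun y hy => mem_choices.2 (h y hy)⟩ le_rfl

/-- The winning condition of run-trees: the limit superior of the sequence of colours is an even
element of `C`. -/
def parityObjective (C : Finset ℕ) (B : Set (Col C)) : Prop :=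
  ∃ k : C, IsLeast B (k : Col C) ∧ Even (k : ℕ)

theorem parityObjective_eventualBounds_iff {c : ℕ → Col C} :
    parityObjective C (eventualBounds c) ↔
      ∃ k : C, (∃ᶠ n in Filter.atTop, c n = (k : Col C)) ∧
        (∀ d : C, (∃ᶠ n in Filter.atTop, c n = (d : Col C)) → d ≤ k) ∧ Even (k : ℕ) := by
  refine exists_congr fun k => ?_
  rw [isLeast_eventualBounds_iff, and_assoc]
  simp only [WithBot.forall, WithBot.coe_le_coe, bot_le, implies_true, true_and]

theorem win_runGame_of_le {s s' : Bang (Box C X)} {a a' : A}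
    (h : Win (parityObjective C) (runGame R) (s, a)) (hs : s ≤ s') (ha : a' ≤ a) :
    Win (parityObjective C) (runGame R) (s', a') := by
  refine h.simulate (fun p p' => p.1 ≤ p'.1 ∧ p'.2 ≤ p.2) ?_ ⟨hs, ha⟩
  rintro p p' V ⟨h₁, h₂⟩ hV
  exact runGame_move (down R hV ⟨h₁, le_rfl⟩ h₂) fun y hy =>
    ⟨_, mem_choices.1 hy, Bang.unpaint_mono _ h₁, le_rfl⟩

end Game

/-! ### Run-trees as strategies -/

section RunTree

open ColouredGame ColouredGraph

variable {C : Finset ℕ} {X A : FinScottL.{u}}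

theorem ColTree.Winning.parityObjective {L : Type u} {t : ColTree C L} (ht : t.Winning)
    {s : ℕ → ℕ} (hs : ∀ n, t.IsNode (ColTree.pos s n)) :
    parityObjective C (eventualBounds fun n => t.col (ColTree.pos s n)) :=
  parityObjective_eventualBounds_iff.2 (ht s hs)

section Strategy

variable {R : colObj C X ⊗ colObj C A ⟶ A} {t : ColTree C (X ⊕ A)} {s : Bang (Box C X)} {a : A}

theorem ColTree.childrenX_le_unpaint {p : List ℕ} (hp : t.IsNode p)
    (hl : t.leaves = {y | y ∈ s}) : t.childrenX p ≤ Bang.unpaint (t.pathCol p) s := by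
  refine Bang.le_unpaint_iff.2 fun y hy => ?_
  obtain ⟨i, hi, hcol, hlabel⟩ := (Bang.mem_ofSet _ y).1 hy
  have hleaf : (⟨max (t.pathCol p) y.col, y.val⟩ : Box C X) ∈ t.leaves :=
    ⟨i :: p, ⟨hp, hi⟩, hlabel, by rw [pathCol, hcol, max_comm]⟩
  rw [hl] at hleaf
  exact ⟨_, hleaf, rfl, le_rfl⟩

theorem ColTree.IsRunTree.win (ht : t.IsRunTree R a) (hw : t.Winning)
    (hl : t.leaves = {y | y ∈ s}) : Win (parityObjective C) (runGame R) (s, a) := by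
  let Q := {x : List ℕ × A // t.IsNode x.1 ∧ t.label x.1 = Sum.inr x.2}
  let position (x : Q) : Bang (Box C X) × A := (Bang.unpaint (t.pathCol x.1.1) s, x.1.2)
  let edge (x : Q) (c : Col C) (y : Q) : Prop := ∃ i, y.1.1 = i :: x.1.1 ∧ t.col y.1.1 = c
  have legal (x : Q) :
      (runGame R).move (position x) {m | ∃ y, edge x m.1 y ∧ position y = m.2} := by
    obtain ⟨⟨p, b⟩, hp, hb⟩ := x
    refine runGame_move
      (down R (ht.step p b hp hb) ⟨childrenX_le_unpaint hp hl, le_rfl⟩ le_rfl) fun y hy => ?_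
    obtain ⟨i, hi, hcol, hlabel⟩ := (Bang.mem_ofSet _ y).1 hy
    refine ⟨⟨(i :: p, y.val), ⟨hp, hi⟩, hlabel⟩, ⟨i, rfl, hcol⟩, Prod.ext ?_ rfl⟩
    change Bang.unpaint (t.pathCol (i :: p)) s = Bang.unpaint y.col (Bang.unpaint _ s)
    rw [Bang.unpaint_unpaint, pathCol, hcol, max_comm]
  have root_wins : Win (parityObjective C) (runGame R)
      (position ⟨([], a), trivial, ht.root_label⟩) := by
    refine Win.of_root _ legal fun x c hx₀ hE => ?_
    choose i hi hc using hE
    have hpos (n : ℕ) : ColTree.pos i n = (x n).1.1 := by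
      induction n with
      | zero => rw [hx₀]; rfl
      | succ n ih => rw [hi n, ← ih]; rfl
    have := hw.parityObjective fun n => hpos n ▸ (x n).2.1
    rw [← eventualBounds_comp_add _ 1] at this
    convert this using 3 with n
    rw [hpos, hc]
  refine win_runGame_of_le root_wins ?_ le_rfl
  change Bang.unpaint (t.col []) s ≤ s
  rw [ht.root_col]
  exact Bang.unpaint_bot_le s

end Strategy

/-- A finitely branching coloured graph whose vertices are labelled in `A`. Each vertex has
finitely many successors and finitely many leaves labelled in `X`. -/
structure RunGraph (C : Finset ℕ) (X A : Type u) where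
  Vertex : Type u
  label : Vertex → A
  leaves : Vertex → Bang (Box C X)
  succ : Vertex → Bang (Box C Vertex)

namespace RunGraph

section Unfolding

variable {X A : Type u} (G : RunGraph C X A)

/-- The leaves and the successors of a vertex, in some order. A leaf has no children. -/
noncomputable def children : Col C × (X ⊕ G.Vertex) → List (Col C × (X ⊕ G.Vertex))
  | (_, Sum.inl _) => []
  | (_, Sum.inr q) => (G.leaves q).elems.toList.map (fun y => (y.col, Sum.inl y.val)) ++
      (G.succ q).elems.toList.map fun y => (y.col, Sum.inr y.val)

/-- The leaf or the vertex at an address of the unfolding, and the colour of the last edge of the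
path to it. -/
noncomputable def node (q₀ : G.Vertex) : List ℕ → Col C × (X ⊕ G.Vertex)
  | [] => (⊥, Sum.inr q₀)
  | i :: p => (G.children (node q₀ p))[i]?.getD (⊥, Sum.inr q₀)

/-- The tree of the finite paths from a vertex. -/
noncomputable def unfolding (q₀ : G.Vertex) : ColTree C (X ⊕ A) where
  arity p := (G.children (G.node q₀ p)).length
  label p := (G.node q₀ p).2.map id G.label
  col p := (G.node q₀ p).1

variable {G} {q₀ q : G.Vertex} {p : List ℕ}

theorem inl_mem_children {c d : Col C} {x : X} :
    (d, Sum.inl x) ∈ G.children (c, Sum.inr q) ↔ (⟨d, x⟩ : Box C X) ∈ G.leaves q := by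
  simp only [children, List.mem_append, List.mem_map, Finset.mem_toList, Prod.mk.injEq,
    Sum.inl.injEq, reduceCtorEq, and_false, exists_false, or_false]
  exact ⟨fun ⟨_, hy, hc, hx⟩ => hc ▸ hx ▸ hy, fun h => ⟨_, h, rfl, rfl⟩⟩

theorem inr_mem_children {c d : Col C} {r : G.Vertex} :
    (d, Sum.inr r) ∈ G.children (c, Sum.inr q) ↔ (⟨d, r⟩ : Box C G.Vertex) ∈ G.succ q := by
  simp only [children, List.mem_append, List.mem_map, Finset.mem_toList, Prod.mk.injEq,
    Sum.inr.injEq, reduceCtorEq, and_false, exists_false, false_or]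
  exact ⟨fun ⟨_, hy, hc, hx⟩ => hc ▸ hx ▸ hy, fun h => ⟨_, h, rfl, rfl⟩⟩

theorem node_cons_mem {i : ℕ} (h : i < (G.unfolding q₀).arity p) :
    G.node q₀ (i :: p) ∈ G.children (G.node q₀ p) := by
  rw [node, List.getElem?_eq_getElem h]
  exact List.getElem_mem h

theorem exists_node_cons {n : Col C × (X ⊕ G.Vertex)} (h : n ∈ G.children (G.node q₀ p)) :
    ∃ i < (G.unfolding q₀).arity p, G.node q₀ (i :: p) = n := by
  obtain ⟨i, hi, rfl⟩ := List.mem_iff_getElem.1 h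
  exact ⟨i, hi, by rw [node, List.getElem?_eq_getElem hi]; rfl⟩

theorem exists_node_eq_inr (h : 0 < (G.unfolding q₀).arity p) :
    ∃ c q, G.node q₀ p = (c, Sum.inr q) := by
  rcases hn : G.node q₀ p with ⟨c, x | q⟩
  · simp [unfolding, hn, children] at h
  · exact ⟨c, q, rfl⟩

theorem label_unfolding_eq_inl {x : X} :
    (G.unfolding q₀).label p = Sum.inl x ↔ ∃ c, G.node q₀ p = (c, Sum.inl x) := by
  rcases hn : G.node q₀ p with ⟨c, y | q⟩ <;> simp [unfolding, hn]

theorem label_unfolding_eq_inr {a : A} :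
    (G.unfolding q₀).label p = Sum.inr a ↔ ∃ c q, G.node q₀ p = (c, Sum.inr q) ∧ G.label q = a := by
  rcases hn : G.node q₀ p with ⟨c, y | q⟩ <;> simp [unfolding, hn]

end Unfolding

variable {G : RunGraph C X A} {q₀ q : G.Vertex} {p : List ℕ} {c : Col C}

theorem mem_childrenX_unfolding (hp : G.node q₀ p = (c, Sum.inr q)) {y : Box C X}
    (hy : y ∈ G.leaves q) : y ∈ (G.unfolding q₀).childrenX p := by
  obtain ⟨i, hi, h⟩ := exists_node_cons (hp ▸ inl_mem_children.2 hy)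
  exact (Bang.mem_ofSet _ _).2
    ⟨i, hi, congrArg Prod.fst h, label_unfolding_eq_inl.2 ⟨_, h⟩⟩

theorem mem_childrenA_unfolding (hp : G.node q₀ p = (c, Sum.inr q)) {r : Box C G.Vertex}
    (hr : r ∈ G.succ q) : (⟨r.col, G.label r.val⟩ : Box C A) ∈ (G.unfolding q₀).childrenA p := by
  obtain ⟨i, hi, h⟩ := exists_node_cons (hp ▸ inr_mem_children.2 hr)
  exact (Bang.mem_ofSet _ _).2
    ⟨i, hi, congrArg Prod.fst h, label_unfolding_eq_inr.2 ⟨_, _, h, rfl⟩⟩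

theorem isRunTree_unfolding {R : colObj C X ⊗ colObj C A ⟶ A}
    (h : ∀ q, ∃ v : Bang (Box C A), R.rel (G.leaves q, v) (G.label q) ∧
      ∀ y ∈ v, ∃ r, (⟨y.col, r⟩ : Box C G.Vertex) ∈ G.succ q ∧ G.label r = y.val)
    (q₀ : G.Vertex) : (G.unfolding q₀).IsRunTree R (G.label q₀) where
  root_label := rfl
  root_col := rfl
  inner p _ hp := by
    obtain ⟨c, q, hq⟩ := exists_node_eq_inr hp
    exact ⟨G.label q, label_unfolding_eq_inr.2 ⟨c, q, hq, rfl⟩⟩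
  step p b _ hb := by
    obtain ⟨c, q, hq, rfl⟩ := label_unfolding_eq_inr.1 hb
    obtain ⟨v, hv, hsucc⟩ := h q
    refine down R hv ⟨Bang.le_of_subset fun y => mem_childrenX_unfolding hq,
      Bang.le_of_subset fun y hy => ?_⟩ le_rfl
    obtain ⟨r, hr, hlabel⟩ := hsucc y hy
    have := mem_childrenA_unfolding hq hr
    rwa [hlabel] at this

theorem winning_unfolding
    (h : Sound (parityObjective C) fun q c r => (⟨c, r⟩ : Box C G.Vertex) ∈ G.succ q)
    (q₀ : G.Vertex) : (G.unfolding q₀).Winning := by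
  intro s hs
  choose c q hq using fun n => exists_node_eq_inr (Nat.zero_lt_of_lt (hs (n + 1)).2)
  rw [← parityObjective_eventualBounds_iff, ← eventualBounds_comp_add _ 1]
  have hcol (n : ℕ) : (G.unfolding q₀).col (ColTree.pos s n) = c n := congrArg Prod.fst (hq n)
  simp only [hcol]
  refine h q _ fun n => ?_
  have hmem := node_cons_mem (hs (n + 1)).2
  rw [← ColTree.pos, hq (n + 1), hq n] at hmem
  exact inr_mem_children.1 hmem

theorem paint_leaves (h : ∀ q, ∀ r ∈ G.succ q, Bang.Paint r.col (G.leaves r.val) (G.leaves q))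
    (hp : (G.unfolding q₀).IsNode p) (hq : G.node q₀ p = (c, Sum.inr q)) :
    Bang.Paint ((G.unfolding q₀).pathCol p) (G.leaves q) (G.leaves q₀) := by
  induction p generalizing c q with
  | nil =>
    cases hq
    exact Bang.paint_bot.2 le_rfl
  | cons i p ih =>
    obtain ⟨c', q', hq'⟩ := exists_node_eq_inr (Nat.zero_lt_of_lt hp.2)
    have hmem := node_cons_mem hp.2
    rw [hq, hq'] at hmem
    have hcol : (G.unfolding q₀).col (i :: p) = c := congrArg Prod.fst hq
    rw [ColTree.pathCol, hcol, max_comm]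
    exact (h q' _ (inr_mem_children.1 hmem)).trans (ih hp.1 hq')

theorem leaves_unfolding_le
    (h : ∀ q, ∀ r ∈ G.succ q, Bang.Paint r.col (G.leaves r.val) (G.leaves q)) (q₀ : G.Vertex) :
    (Bang.ofSet (G.unfolding q₀).leaves : Bang (Box C X)) ≤ G.leaves q₀ := by
  intro y hy
  obtain ⟨p, hp, hlabel, hcol⟩ := (Bang.mem_ofSet _ y).1 hy
  obtain ⟨c, hc⟩ := label_unfolding_eq_inl.1 hlabel
  cases p with
  | nil => cases hc
  | cons i p =>
    obtain ⟨c', q, hq⟩ := exists_node_eq_inr (Nat.zero_lt_of_lt hp.2)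
    have hmem := node_cons_mem hp.2
    rw [hc, hq] at hmem
    have hcol' : (G.unfolding q₀).col (i :: p) = c := congrArg Prod.fst hc
    obtain ⟨x, hx, hxc, hyx⟩ := paint_leaves h hp.1 hq _ (inl_mem_children.1 hmem)
    exact ⟨x, hx, by rw [← hcol, ColTree.pathCol, hcol', max_comm, hxc], hyx⟩

theorem fixOp_rel {R : colObj C X ⊗ colObj C A ⟶ A}
    (run : ∀ q, ∃ v : Bang (Box C A), R.rel (G.leaves q, v) (G.label q) ∧
      ∀ y ∈ v, ∃ r, (⟨y.col, r⟩ : Box C G.Vertex) ∈ G.succ q ∧ G.label r = y.val)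
    (sound : Sound (parityObjective C) fun q c r => (⟨c, r⟩ : Box C G.Vertex) ∈ G.succ q)
    (paint : ∀ q, ∀ r ∈ G.succ q, Bang.Paint r.col (G.leaves r.val) (G.leaves q))
    (q₀ : G.Vertex) : (fixOp C X A R).rel (G.leaves q₀) (G.label q₀) := by
  have h : (fixOp C X A R).rel (Bang.ofSet (G.unfolding q₀).leaves) (G.label q₀) :=
    ⟨_, isRunTree_unfolding run q₀, winning_unfolding sound q₀,
      Set.ext fun y => (Bang.mem_ofSet _ y).symm⟩
  exact down _ h (leaves_unfolding_le paint q₀) le_rfl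

end RunGraph

variable {R : colObj C X ⊗ colObj C A ⟶ A} {s : Bang (Box C X)} {a : A}

theorem fixOp_rel_of_win (h : Win (parityObjective C) (runGame R) (s, a)) :
    (fixOp C X A R).rel s a := by
  classical
  obtain ⟨σ, q₀, hq₀⟩ := h
  let v (q : σ.State) : Bang (Box C A) :=
    choices (σ.pos q).1 {m | ∃ q', σ.edge q m.1 q' ∧ σ.pos q' = m.2}
  have exists_next (q : σ.State) (y : Box C A) (hy : y ∈ v q) :
      ∃ q', σ.edge q y.col q' ∧ σ.pos q' = (Bang.unpaint y.col (σ.pos q).1, y.val) :=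
    mem_choices.1 hy
  have : Nonempty σ.State := ⟨q₀⟩
  choose! next hedge hpos using exists_next
  let succ (q : σ.State) : Bang (Box C σ.State) :=
    ⟨(v q).elems.image fun y => ⟨y.col, next q y⟩⟩
  have mem_succ {q : σ.State} {r : Box C σ.State} :
      r ∈ succ q ↔ ∃ y ∈ v q, ⟨y.col, next q y⟩ = r := Finset.mem_image
  have edge_of_mem_succ {q : σ.State} {r : Box C σ.State} (hr : r ∈ succ q) :
      σ.edge q r.col r.val := by
    obtain ⟨y, hy, rfl⟩ := mem_succ.1 hr
    exact hedge q y hy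
  have all_rel (q : σ.State) : (fixOp C X A R).rel (σ.pos q).1 (σ.pos q).2 := by
    refine RunGraph.fixOp_rel (G := ⟨σ.State, fun q => (σ.pos q).2, fun q => (σ.pos q).1, succ⟩)
      (fun q => ⟨v q, σ.legal q, fun y hy => ?_⟩)
      (fun q c h => σ.sound q c fun n => edge_of_mem_succ (h n)) (fun q r hr => ?_) q
    · exact ⟨next q y, mem_succ.2 ⟨y, hy, rfl⟩, congrArg Prod.snd (hpos q y hy)⟩
    · obtain ⟨y, hy, rfl⟩ := mem_succ.1 hr
      exact Bang.le_unpaint_iff.1 (congrArg Prod.fst (hpos q y hy)).le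
  simpa only [hq₀] using all_rel q₀

theorem fixOp_rel_iff :
    (fixOp C X A R).rel s a ↔ Win (parityObjective C) (runGame R) (s, a) :=
  ⟨fun ⟨_, ht, hw, hl⟩ => ht.win hw hl, fixOp_rel_of_win⟩

end RunTree

/-! ### The structural morphisms -/

section Value

variable {A B D : FinScottL.{u}}

/-- The elements to which `Q` relates `a` are those below `b`, so that `Q` acts on `a` as a function
with the value `b`. -/
def IsValue (Q : A ⟶ B) (a : A) (b : B) : Prop := ∀ x, Q.rel a x ↔ x ≤ b

variable {Q : A ⟶ B} {a : A} {b : B}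

theorem IsValue.comp_rel_iff (h : IsValue Q a b) {R : B ⟶ D} {d : D} :
    Hom.rel (Q ≫ R) a d ↔ R.rel b d :=
  ⟨fun ⟨x, hx, hR⟩ => down R hR ((h x).1 hx) le_rfl, fun hR => ⟨b, (h b).2 le_rfl, hR⟩⟩

theorem IsValue.comp {R : B ⟶ D} {d : D} (h : IsValue Q a b) (h' : IsValue R b d) :
    IsValue (Q ≫ R) a d := fun x => h.comp_rel_iff.trans (h' x)

theorem IsValue.whiskerRight (h : IsValue Q a b) (d : D) : IsValue (Q ▷ D) (a, d) (b, d) :=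
  fun x => and_congr_left' (h x.1)

theorem IsValue.whiskerLeft (h : IsValue Q a b) (d : D) : IsValue (D ◁ Q) (d, a) (d, b) :=
  fun x => and_congr_right' (h x.2)

theorem isValue_associator_hom (a : A) (b : B) (d : D) :
    IsValue (α_ A B D).hom ((a, b), d) (a, (b, d)) := fun _ => Iff.rfl

theorem isValue_associator_inv (a : A) (b : B) (d : D) :
    IsValue (α_ A B D).inv (a, (b, d)) ((a, b), d) := fun _ => Iff.rfl

end Value

section Merge

variable {C : Finset ℕ} {α β : Type u} [Finite α] [Finite β]

theorem Bang.left_merge (s : Bang (Box C α)) (t : Bang (Box C β)) : (Bang.merge s t).left = s :=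
  Bang.ext fun _ => Bang.mem_left.trans Bang.inl_mem_merge

theorem Bang.right_merge (s : Bang (Box C α)) (t : Bang (Box C β)) :
    (Bang.merge s t).right = t :=
  Bang.ext fun _ => Bang.mem_right.trans Bang.inr_mem_merge

theorem Bang.le_merge_iff [Preorder α] [Preorder β] {r : Bang (Box C (α ⊕ β))}
    {s : Bang (Box C α)} {t : Bang (Box C β)} :
    r ≤ Bang.merge s t ↔ r.left ≤ s ∧ r.right ≤ t :=
  ((mergeIso α β).symm_apply_le (x := (s, t)) (y := r)).symm

theorem Bang.merge_mono_right [Preorder α] [Preorder β] (s : Bang (Box C α))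
    {t t' : Bang (Box C β)} (h : t ≤ t') : Bang.merge s t ≤ Bang.merge s t' := by
  rw [Bang.le_merge_iff, Bang.left_merge, Bang.right_merge]
  exact ⟨le_rfl, h⟩

theorem Bang.unpaint_merge [Preorder α] [Preorder β] (c : Col C) (s : Bang (Box C α))
    (t : Bang (Box C β)) :
    Bang.unpaint c (Bang.merge s t) = Bang.merge (Bang.unpaint c s) (Bang.unpaint c t) := by
  refine Bang.ext ?_
  rintro ⟨d, a | b⟩
  · rw [Bang.mem_unpaint, Bang.inl_mem_merge, Bang.mem_unpaint]
    constructor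
    · rintro ⟨⟨e, a' | b'⟩, hx, hc, ha⟩
      · exact ⟨⟨e, a'⟩, Bang.inl_mem_merge.1 hx, hc, Sum.inl_le_inl_iff.1 ha⟩
      · exact (Sum.not_inl_le_inr ha).elim
    · rintro ⟨⟨e, a'⟩, hx, hc, ha⟩
      exact ⟨⟨e, Sum.inl a'⟩, Bang.inl_mem_merge.2 hx, hc, Sum.inl_le_inl_iff.2 ha⟩
  · rw [← Bang.mem_right, unpaint_merge_right, Bang.inr_mem_merge]

end Merge

section Structure

variable {C : Finset ℕ} {X A B : FinScottL.{u}}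

theorem isValue_seely_hom (s : Bang (Box C A)) (t : Bang (Box C B)) :
    IsValue (seely A B).hom (s, t) (Bang.merge s t) := fun _ => Iff.rfl

theorem isValue_seely_inv (s : Bang (Box C (A ⊕ B))) :
    IsValue (seely A B).inv s (s.left, s.right) := fun _ => Iff.rfl

theorem isValue_seely_inv_merge (s : Bang (Box C A)) (t : Bang (Box C B)) :
    IsValue (seely A B).inv (Bang.merge s t) (s, t) := by
  have h := isValue_seely_inv (A := A) (B := B) (Bang.merge s t)
  rwa [Bang.left_merge, Bang.right_merge] at h

theorem isValue_con (s : Bang (Box C A)) : IsValue (con A) s (s, s) := by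
  suffices h : IsValue (colMap C (pair (𝟙 A) (𝟙 A))) s (Bang.merge s s) from
    h.comp (isValue_seely_inv_merge s s)
  intro t
  constructor
  · rintro h ⟨c, a | a⟩ hy
    · obtain ⟨x, hx, hcol, hle⟩ := h _ hy
      exact ⟨⟨x.col, Sum.inl x.val⟩, Bang.inl_mem_merge.2 hx, hcol.symm, Sum.inl_le_inl_iff.2 hle⟩
    · obtain ⟨x, hx, hcol, hle⟩ := h _ hy
      exact ⟨⟨x.col, Sum.inr x.val⟩, Bang.inr_mem_merge.2 hx, hcol.symm, Sum.inr_le_inr_iff.2 hle⟩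
  · rintro h ⟨c, a | a⟩ hy <;> obtain ⟨⟨d, a' | a'⟩, hx, hcol, hle⟩ := h _ hy
    · exact ⟨⟨d, a'⟩, Bang.inl_mem_merge.1 hx, hcol.symm, Sum.inl_le_inl_iff.1 hle⟩
    · exact (Sum.not_inl_le_inr hle).elim
    · exact (Sum.not_inr_le_inl hle).elim
    · exact ⟨⟨d, a'⟩, Bang.inr_mem_merge.1 hx, hcol.symm, Sum.inr_le_inr_iff.1 hle⟩

/-- The value of the promotion of `g` at `s`. -/
noncomputable def promVal (g : colObj C X ⟶ A) (s : Bang (Box C X)) : Bang (Box C A) :=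
  choices s {m | g.rel m.2.1 m.2.2}

theorem isValue_prom (g : colObj C X ⟶ A) (s : Bang (Box C X)) :
    IsValue (prom g) s (promVal g s) := by
  refine fun t => (prom_rel g s t).trans ⟨fun h => Bang.le_of_subset fun y hy => ?_, ?_⟩
  · exact mem_choices.2 (h y hy)
  · intro h y hy
    obtain ⟨⟨d, x⟩, hx, rfl, hle⟩ := h y hy
    exact down g (mem_choices.1 hx) le_rfl hle

theorem unpaint_promVal (g : colObj C X ⟶ A) (c : Col C) (s : Bang (Box C X)) :
    Bang.unpaint c (promVal g s) = promVal g (Bang.unpaint c s) := by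
  refine Bang.ext fun z => ?_
  simp only [promVal, Bang.mem_unpaint, mem_choices, Bang.unpaint_unpaint, Set.mem_ofPred_eq]
  constructor
  · rintro ⟨x, hx, hcol, hle⟩
    exact down g (hcol ▸ hx) le_rfl hle
  · exact fun h => ⟨⟨max c z.col, z.val⟩, h, rfl, le_rfl⟩

theorem isValue_prom₂ (g : colObj C X ⊗ colObj C A ⟶ B) (s : Bang (Box C X))
    (v : Bang (Box C A)) :
    IsValue (prom₂ g) (s, v) (choices s {m | g.rel (m.2.1, Bang.unpaint m.1 v) m.2.2}) := by
  have h := (isValue_seely_hom s v).comp (isValue_prom ((seely X A).inv ≫ g) (Bang.merge s v))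
  suffices hval : choices s {m | g.rel (m.2.1, Bang.unpaint m.1 v) m.2.2} =
      promVal ((seely X A).inv ≫ g) (Bang.merge s v) by rwa [hval]
  refine Bang.ext fun y => mem_choices.trans (Iff.trans ?_ mem_choices.symm)
  have hinv := isValue_seely_inv_merge (Bang.unpaint y.col s) (Bang.unpaint y.col v)
  rw [← Bang.unpaint_merge] at hinv
  exact hinv.comp_rel_iff.symm

theorem IsValue.star_rel_iff {f : colObj C X ⊗ colObj C B ⟶ A} {g : colObj C X ⊗ colObj C A ⟶ B}
    {s : Bang (Box C X)} {v : Bang (Box C A)} {w : Bang (Box C B)} {a : A}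
    (h : IsValue (prom₂ g) (s, v) w) : (star f g).rel (s, v) a ↔ f.rel (s, w) a := by
  refine ((isValue_con s).whiskerRight (D := colObj C A) v).comp_rel_iff.trans ?_
  refine (isValue_associator_hom (A := colObj C X) (B := colObj C X) (D := colObj C A)
    s s v).comp_rel_iff.trans ?_
  exact (h.whiskerLeft (D := colObj C X) s).comp_rel_iff

theorem con_prom_rel_iff {g : colObj C X ⟶ B} {f : colObj C X ⊗ colObj C B ⟶ A}
    {s : Bang (Box C X)} {a : A} :
    Hom.rel (con X ≫ colObj C X ◁ prom g ≫ f) s a ↔ f.rel (s, promVal g s) a :=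
  (isValue_con s).comp_rel_iff.trans
    ((isValue_prom g s).whiskerLeft (D := colObj C X) s).comp_rel_iff

theorem con_associator_rel_iff {f : (colObj C X ⊗ colObj C A) ⊗ colObj C A ⟶ B}
    {s : Bang (Box C X)} {v : Bang (Box C A)} {b : B} :
    Hom.rel (colObj C X ◁ con A ≫ (α_ (colObj C X) (colObj C A) (colObj C A)).inv ≫ f) (s, v) b ↔
      f.rel ((s, v), v) b :=
  ((isValue_con v).whiskerLeft (D := colObj C X) s).comp_rel_iff.trans
    (isValue_associator_inv (A := colObj C X) (B := colObj C A) (D := colObj C A)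
      s v v).comp_rel_iff

end Structure

end FinScottL

/-! ### The Conway identities -/

namespace FinScottL

open ColouredGame SplitGame

variable {C : Finset ℕ} {X Z A B : FinScottL.{u}}

theorem choices_promVal (g : colObj C X ⟶ Z) (s : Bang (Box C X))
    (V : Set (Col C × (Bang (Box C Z) × A))) :
    choices (promVal g s) V = choices s {m | (m.1, (promVal g m.2.1, m.2.2)) ∈ V} :=
  Bang.ext fun y => by simp only [mem_choices, unpaint_promVal, Set.mem_ofPred_eq]

theorem fixOp_natural (g : colObj C X ⟶ Z) (f : colObj C Z ⊗ colObj C A ⟶ A) :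
    fixOp C X A (prom g ▷ colObj C A ≫ f) = prom g ≫ fixOp C Z A f := by
  refine hom_ext fun s a => fixOp_rel_iff.trans (Iff.trans ?_
    ((isValue_prom g s).comp_rel_iff.trans fixOp_rel_iff).symm)
  refine win_iff_of_map (fun p : Bang (Box C X) × A => (promVal g p.1, p.2)) fun p V => ?_
  have hval := (isValue_prom g p.1).whiskerRight (D := colObj C A)
    (choices p.1 {m | (m.1, (promVal g m.2.1, m.2.2)) ∈ V})
  exact hval.comp_rel_iff.trans (iff_of_eq (congrArg (fun v => f.rel (promVal g p.1, v) p.2)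
    (choices_promVal g p.1 V).symm))

theorem fixOp_fixpoint (f : colObj C X ⊗ colObj C A ⟶ A) :
    fixOp C X A f = con X ≫ colObj C X ◁ prom (fixOp C X A f) ≫ f := by
  refine hom_ext fun s a => fixOp_rel_iff.trans (win_iff.trans ?_)
  refine Iff.trans ?_ con_prom_rel_iff.symm
  simp only [promVal, fixOp_rel_iff]
  rfl

/-- The game where `f` and `g` are used alternately, with the elements of `B` as the positions
after an inner move. -/
def starGame (f : colObj C X ⊗ colObj C B ⟶ A) (g : colObj C X ⊗ colObj C A ⟶ B) :
    SplitGame (Col C) (Bang (Box C X) × (A ⊕ B)) where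
  move p V W := p.2.elim
    (fun a => f.rel (p.1, choices p.1 {m | (m.1, (m.2.1, Sum.inr m.2.2)) ∈ V}) a)
    (fun b => g.rel (p.1, choices p.1 {m | (m.1, (m.2.1, Sum.inl m.2.2)) ∈ W}) b)
  mono := by
    rintro ⟨s, a | b⟩ V V' W W' hV hW h
    · exact down f h ⟨le_rfl, choices_mono s fun _ hm => hV hm⟩ le_rfl
    · exact down g h ⟨le_rfl, choices_mono s fun _ hm => hW hm⟩ le_rfl

theorem choices_unpaint_le (c : Col C) (s : Bang (Box C X))
    (V : Set (Col C × (Bang (Box C X) × A))) :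
    choices (Bang.unpaint c s) {m | (c ⊔ m.1, m.2) ∈ V} ≤ Bang.unpaint c (choices s V) := by
  refine Bang.le_of_subset fun y hy => Bang.mem_unpaint.2 ⟨⟨max c y.col, y.val⟩, ?_, rfl, le_rfl⟩
  simpa only [mem_choices, Bang.unpaint_unpaint, Set.mem_ofPred_eq] using hy

theorem unpaint_choices_le (c : Col C) (s : Bang (Box C X))
    (V : Set (Col C × (Bang (Box C X) × A))) :
    Bang.unpaint c (choices s V) ≤ choices (Bang.unpaint c s) {m | (c ⊔ m.1, m.2) ∈ V} := by
  intro z hz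
  obtain ⟨⟨d, a⟩, hx, rfl, hza⟩ := Bang.mem_unpaint.1 hz
  refine ⟨⟨z.col, a⟩, ?_, rfl, hza⟩
  simpa only [mem_choices, Bang.unpaint_unpaint, Set.mem_ofPred_eq] using hx

section Dinatural

variable {f : colObj C X ⊗ colObj C B ⟶ A} {g : colObj C X ⊗ colObj C A ⟶ B}
  {s : Bang (Box C X)}

theorem win_innerGame_starGame_iff {Ω : Set (Col C) → Prop} {c : Col C} {b : B}
    {W : Set (Col C × (Bang (Box C X) × (A ⊕ B)))} :
    Win Ω ((starGame f g).innerGame W) (c, (Bang.unpaint c s, Sum.inr b)) ↔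
      g.rel (Bang.unpaint c s,
        Bang.unpaint c (choices s {m | (m.1, (m.2.1, Sum.inl m.2.2)) ∈ W})) b := by
  have hle := choices_unpaint_le c s {m | (m.1, (m.2.1, Sum.inl m.2.2)) ∈ W}
  have hge := unpaint_choices_le c s {m | (m.1, (m.2.1, Sum.inl m.2.2)) ∈ W}
  refine win_iff.trans ⟨fun h => ?_, fun h => ?_⟩
  · exact down g h ⟨le_rfl, hle⟩ le_rfl
  · exact down g h ⟨le_rfl, hge⟩ le_rfl

theorem accelerated_starGame_move_iff {Ω : Set (Col C) → Prop} {a : A}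
    {W : Set (Col C × (Bang (Box C X) × (A ⊕ B)))} :
    ((starGame f g).accelerated Ω).move (s, Sum.inl a) W ↔
      (runGame (star f g)).move (s, a) {m | (m.1, (m.2.1, Sum.inl m.2.2)) ∈ W} := by
  refine win_iff.trans (Iff.trans ?_ (isValue_prom₂ g _ _).star_rel_iff.symm)
  refine iff_of_eq (congrArg (fun w => f.rel (s, w) a) (Bang.ext fun y => ?_))
  simp only [mem_choices, Set.mem_ofPred_eq, bot_sup_eq, win_innerGame_starGame_iff]

theorem fixOp_star_rel_iff {a : A} :
    (fixOp C X A (star f g)).rel s a ↔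
      Win (parityObjective C) (starGame f g).merged (s, Sum.inl a) := by
  rw [fixOp_rel_iff, ← win_accelerated_iff]
  exact win_iff_of_map (fun p : Bang (Box C X) × A => (p.1, Sum.inl p.2)) fun _ _ =>
    accelerated_starGame_move_iff.symm

theorem win_starGame_swap_iff {Ω : Set (Col C) → Prop} {x : A ⊕ B} :
    Win Ω (starGame f g).merged (s, x) ↔ Win Ω (starGame g f).merged (s, x.swap) := by
  refine win_iff_of_map (fun p : Bang (Box C X) × (A ⊕ B) => (p.1, p.2.swap)) ?_
  rintro ⟨s, a | b⟩ V <;> rfl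

theorem fixOp_dinatural (f : colObj C X ⊗ colObj C B ⟶ A) (g : colObj C X ⊗ colObj C A ⟶ B) :
    fixOp C X A (star f g) = con X ≫ colObj C X ◁ prom (fixOp C X B (star g f)) ≫ f := by
  have win_inr {s : Bang (Box C X)} {b : B} : (fixOp C X B (star g f)).rel s b ↔
      Win (parityObjective C) (starGame f g).merged (s, Sum.inr b) :=
    fixOp_star_rel_iff.trans win_starGame_swap_iff
  refine hom_ext fun s a => fixOp_star_rel_iff.trans (win_iff.trans ?_)
  refine Iff.trans ?_ con_prom_rel_iff.symm
  simp only [promVal, win_inr]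
  rfl

end Dinatural

section Diagonal

variable {f : (colObj C X ⊗ colObj C A) ⊗ colObj C A ⟶ A}

/-- The game of a morphism with two arguments in `A`, of which the first one gives the outer
moves. -/
def diagGame (f : (colObj C X ⊗ colObj C A) ⊗ colObj C A ⟶ A) :
    SplitGame (Col C) (Bang (Box C X) × A) where
  move p V W := f.rel ((p.1, choices p.1 W), choices p.1 V) p.2
  mono _ _ _ _ _ hV hW h :=
    down f h ⟨⟨le_rfl, choices_mono _ hW⟩, choices_mono _ hV⟩ le_rfl

theorem seely_inv_whiskerRight_rel_iff {s : Bang (Box C X)} {v w : Bang (Box C A)} {a : A} :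
    Hom.rel ((seely X A).inv ▷ colObj C A ≫ f) (Bang.merge s v, w) a ↔ f.rel ((s, v), w) a :=
  ((isValue_seely_inv_merge s v).whiskerRight (D := colObj C A) w).comp_rel_iff

variable {Ω : Set (Col C) → Prop} {W : Set (Col C × (Bang (Box C X) × A))}

/-- The parameter of the game of `f` which corresponds to the position `x` of the inner game: its
second component consists of the allowed outer moves. -/
noncomputable def outerParameter (W : Set (Col C × (Bang (Box C X) × A)))
    (x : Col C × (Bang (Box C X) × A)) : Bang (Box C (X ⊕ A)) :=
  Bang.merge x.2.1 (choices x.2.1 {m | (x.1 ⊔ m.1, m.2) ∈ W})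

theorem outerParameter_le (x : Col C × (Bang (Box C X) × A)) (y : Box C A) :
    outerParameter W (x.1 ⊔ y.col, (Bang.unpaint y.col x.2.1, y.val)) ≤
      Bang.unpaint y.col (outerParameter W x) := by
  rw [outerParameter, outerParameter, Bang.unpaint_merge]
  simp only [sup_assoc]
  exact Bang.merge_mono_right _ (choices_unpaint_le y.col x.2.1 {m | (x.1 ⊔ m.1, m.2) ∈ W})

theorem le_outerParameter (x : Col C × (Bang (Box C X) × A)) (y : Box C A) :
    Bang.unpaint y.col (outerParameter W x) ≤
      outerParameter W (x.1 ⊔ y.col, (Bang.unpaint y.col x.2.1, y.val)) := by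
  rw [outerParameter, outerParameter, Bang.unpaint_merge]
  simp only [sup_assoc]
  exact Bang.merge_mono_right _ (unpaint_choices_le y.col x.2.1 {m | (x.1 ⊔ m.1, m.2) ∈ W})

theorem win_innerGame_diagGame_iff {x : Col C × (Bang (Box C X) × A)} :
    Win Ω ((diagGame f).innerGame W) x ↔
      Win Ω (runGame ((seely X A).inv ▷ colObj C A ≫ f)) (outerParameter W x, x.2.2) := by
  constructor <;> intro h
  · refine h.simulate (fun x p => outerParameter W x ≤ p.1 ∧ x.2.2 = p.2) ?_ ⟨le_rfl, rfl⟩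
    rintro x ⟨s, _⟩ V ⟨hs, rfl⟩ hV
    refine down _ (seely_inv_whiskerRight_rel_iff.2 hV) ⟨hs, ?_⟩ le_rfl
    refine Bang.le_of_subset fun y hy => mem_choices.2 ⟨_, mem_choices.1 hy, ?_, rfl⟩
    exact (outerParameter_le x y).trans (Bang.unpaint_mono _ hs)
  · refine h.simulate (fun p x => p.1 ≤ outerParameter W x ∧ x.2.2 = p.2) ?_ ⟨le_rfl, rfl⟩
    rintro ⟨s, _⟩ x V ⟨hs, rfl⟩ hV
    refine seely_inv_whiskerRight_rel_iff.1 (down _ hV ⟨hs, ?_⟩ le_rfl)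
    refine Bang.le_of_subset fun y hy => mem_choices.2 ⟨_, mem_choices.1 hy, ?_, rfl⟩
    exact (Bang.unpaint_mono _ hs).trans (le_outerParameter x y)

theorem accelerated_diagGame_move_iff {p : Bang (Box C X) × A} :
    ((diagGame f).accelerated (parityObjective C)).move p W ↔
      (runGame ((seely X A).hom ≫
        fixOp C (withObj X A) A ((seely X A).inv ▷ colObj C A ≫ f))).move p W := by
  refine Iff.trans ?_ (isValue_seely_hom p.1 (choices p.1 W)).comp_rel_iff.symm
  refine win_innerGame_diagGame_iff.trans (Iff.trans ?_ fixOp_rel_iff.symm)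
  simp only [outerParameter, bot_sup_eq]
  rfl

theorem fixOp_diagonal (f : (colObj C X ⊗ colObj C A) ⊗ colObj C A ⟶ A) :
    fixOp C X A ((seely X A).hom ≫
      fixOp C (withObj X A) A ((seely X A).inv ▷ colObj C A ≫ f)) =
    fixOp C X A (colObj C X ◁ con A ≫ (α_ (colObj C X) (colObj C A) (colObj C A)).inv ≫ f) := by
  refine hom_ext fun s a => fixOp_rel_iff.trans (Iff.trans ?_ fixOp_rel_iff.symm)
  refine (win_iff_of_map id fun _ _ => accelerated_diagGame_move_iff.symm).trans ?_
  refine win_accelerated_iff.trans ?_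
  exact win_iff_of_map id fun _ _ => con_associator_rel_iff.symm

end Diagonal

theorem isConwayOperator_fixOp (C : Finset ℕ) : IsConwayOperator.{u} C (fixOp C) where
  natural := fixOp_natural
  fixpoint := fixOp_fixpoint
  dinatural := fixOp_dinatural
  diagonal := fixOp_diagonal

end FinScottL

/-! ### The Kleisli category -/

namespace FinScottL

open CartesianMonoidalCategory

section Promotion

variable {C : Finset ℕ} {X Z A B D : FinScottL.{u}}

theorem prom_colDer_comp (R : A ⟶ B) : prom (colDer C A ≫ R) = colMap C R := by
  have h := (colBang C).right_counit A
  change (colBang C).δ.app A ≫ (colBang C).map ((colBang C).ε.app A ≫ R) = (colBang C).map R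
  rw [Functor.map_comp, ← Category.assoc, h, Category.id_comp]

theorem prom_prom_comp (f : colObj C X ⟶ A) (g : colObj C A ⟶ B) :
    prom (prom f ≫ g) = prom f ≫ prom g := by
  refine hom_ext fun s t =>
    (prom_rel _ s t).trans (Iff.trans ?_ (isValue_prom f s).comp_rel_iff.symm)
  refine Iff.trans (forall₂_congr fun y _ => ?_) (prom_rel g _ t).symm
  have hval := unpaint_promVal f y.col s
  exact (isValue_prom f (Bang.unpaint y.col s)).comp_rel_iff.trans
    (iff_of_eq (congrArg (fun t => g.rel t y.val) hval.symm))

theorem prom₂_seely_hom_comp (g : colObj C (withObj X A) ⟶ B) :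
    prom₂ ((seely X A).hom ≫ g) = (seely X A).hom ≫ prom g := by
  rw [prom₂, Iso.inv_hom_id_assoc]

theorem isValue_prom_colDer (s : Bang (Box C A)) : IsValue (prom (colDer C A)) s s := by
  have h : prom (colDer C A) = 𝟙 (colObj C A) := (colBang C).right_counit A
  rw [h]
  exact fun _ => Iff.rfl

theorem isValue_prom_colDer_proj₁ (s : Bang (Box C A)) (t : Bang (Box C B)) :
    IsValue (prom (colDer C (withObj A B) ≫ proj₁ A B)) (Bang.merge s t) s := by
  rw [prom_colDer_comp]
  refine fun r => (colMap_rel _ _ r).trans ⟨fun h y hy => ?_, fun h y hy => ?_⟩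
  · obtain ⟨⟨c, a | b⟩, hx, hcol, hle⟩ := h y hy
    · exact ⟨⟨c, a⟩, Bang.inl_mem_merge.1 hx, hcol.symm, Sum.inl_le_inl_iff.1 hle⟩
    · exact (Sum.not_inl_le_inr hle).elim
  · obtain ⟨x, hx, hcol, hle⟩ := h y hy
    exact ⟨⟨x.col, Sum.inl x.val⟩, Bang.inl_mem_merge.2 hx, hcol.symm, Sum.inl_le_inl_iff.2 hle⟩

theorem isValue_prom_colDer_proj₂ (s : Bang (Box C A)) (t : Bang (Box C B)) :
    IsValue (prom (colDer C (withObj A B) ≫ proj₂ A B)) (Bang.merge s t) t := by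
  intro r
  rw [prom_colDer_comp, ← Category.comp_id (colMap C (proj₂ A B))]
  refine (colMap_proj₂_comp_rel _ _ r).trans ?_
  rw [Bang.right_merge]
  rfl

theorem IsValue.prom_pair {f : colObj C X ⟶ A} {g : colObj C X ⟶ B} {r : Bang (Box C X)}
    {s : Bang (Box C A)} {t : Bang (Box C B)} (hf : IsValue (prom f) r s)
    (hg : IsValue (prom g) r t) : IsValue (prom (FinScottL.pair f g)) r (Bang.merge s t) := by
  intro z
  have hz : (prom (FinScottL.pair f g)).rel r z ↔
      (prom f).rel r z.left ∧ (prom g).rel r z.right := by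
    refine (prom_rel _ r z).trans (Iff.trans ?_ (and_congr (prom_rel f r _) (prom_rel g r _)).symm)
    constructor
    · exact fun h => ⟨fun y hy => h ⟨y.col, Sum.inl y.val⟩ (Bang.mem_left.1 hy),
        fun y hy => h ⟨y.col, Sum.inr y.val⟩ (Bang.mem_right.1 hy)⟩
    · rintro ⟨hleft, hright⟩ ⟨c, a | b⟩ hy
      · exact hleft ⟨c, a⟩ (Bang.mem_left.2 hy)
      · exact hright ⟨c, b⟩ (Bang.mem_right.2 hy)
  exact hz.trans ((and_congr (hf _) (hg _)).trans Bang.le_merge_iff.symm)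

theorem seely_hom_prom_pair_proj (g : colObj C X ⟶ Z) (f : colObj C (withObj Z A) ⟶ D) :
    (seely X A).hom ≫ prom (FinScottL.pair (prom (colDer C (withObj X A) ≫ proj₁ X A) ≫ g)
      (colDer C (withObj X A) ≫ proj₂ X A)) ≫ f =
      prom g ▷ colObj C A ≫ (seely Z A).hom ≫ f := by
  refine hom_ext fun ⟨s, v⟩ d => ?_
  have hfst : IsValue (prom (prom (colDer C (withObj X A) ≫ proj₁ X A) ≫ g)) (Bang.merge s v)
      (promVal g s) := by
    rw [prom_prom_comp]
    exact (isValue_prom_colDer_proj₁ s v).comp (isValue_prom g s)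
  refine (isValue_seely_hom s v).comp_rel_iff.trans
    ((hfst.prom_pair (isValue_prom_colDer_proj₂ s v)).comp_rel_iff.trans ?_)
  exact (((isValue_prom g s).whiskerRight (D := colObj C A) v).comp_rel_iff.trans
    (isValue_seely_hom _ v).comp_rel_iff).symm

theorem con_prom_seely (g : colObj C X ⟶ A) (f : colObj C (withObj X A) ⟶ D) :
    con X ≫ colObj C X ◁ prom g ≫ (seely X A).hom ≫ f =
      prom (FinScottL.pair (colDer C X) g) ≫ f :=
  hom_ext fun s _ => con_prom_rel_iff.trans ((isValue_seely_hom s _).comp_rel_iff.trans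
    ((isValue_prom_colDer s).prom_pair (isValue_prom g s)).comp_rel_iff.symm)

theorem seely_hom_prom_pair_star (f : colObj C (withObj X B) ⟶ A)
    (g : colObj C (withObj X A) ⟶ B) :
    (seely X A).hom ≫ prom (FinScottL.pair (colDer C (withObj X A) ≫ proj₁ X A) g) ≫ f =
      star ((seely X B).hom ≫ f) ((seely X A).hom ≫ g) := by
  refine hom_ext fun ⟨s, v⟩ a => ?_
  have hg : IsValue (prom₂ ((seely X A).hom ≫ g)) (s, v) (promVal g (Bang.merge s v)) := by
    rw [prom₂_seely_hom_comp]
    exact (isValue_seely_hom s v).comp (isValue_prom g _)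
  refine (isValue_seely_hom s v).comp_rel_iff.trans
    (((isValue_prom_colDer_proj₁ s v).prom_pair (isValue_prom g _)).comp_rel_iff.trans ?_)
  refine Iff.trans ?_ (hg.star_rel_iff).symm
  exact (isValue_seely_hom s _).comp_rel_iff.symm

theorem seely_hom_prom_pair_diag (f : colObj C (withObj (withObj X A) A) ⟶ A) :
    (seely X A).hom ≫ prom (FinScottL.pair (colDer C (withObj X A))
      (colDer C (withObj X A) ≫ proj₂ X A)) ≫ f =
    colObj C X ◁ con A ≫ (α_ (colObj C X) (colObj C A) (colObj C A)).inv ≫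
      (seely X A).hom ▷ colObj C A ≫ (seely (withObj X A) A).hom ≫ f := by
  refine hom_ext fun ⟨s, v⟩ a => ?_
  have hpair := (isValue_prom_colDer (A := withObj X A) (Bang.merge s v)).prom_pair
    (isValue_prom_colDer_proj₂ s v)
  have hseely := ((isValue_seely_hom s v).whiskerRight (D := colObj C A) v).comp
    (isValue_seely_hom (A := withObj X A) (Bang.merge s v) v)
  refine (isValue_seely_hom s v).comp_rel_iff.trans (hpair.comp_rel_iff.trans ?_)
  refine Iff.trans ?_ con_associator_rel_iff.symm
  rw [← Category.assoc]
  exact hseely.comp_rel_iff.symm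

end Promotion

section Kleisli

variable {C : Finset ℕ} {X Z A B : Cokleisli (colBang.{u} C)}

theorem kleisli_comp_of (f : X ⟶ A) (g : A ⟶ B) : (f ≫ g).of = prom f.of ≫ g.of :=
  (Category.assoc _ _ _).symm

theorem kleisli_whiskerRight_of (g : X ⟶ Z) (A : Cokleisli (colBang.{u} C)) :
    (g ▷ A).of = FinScottL.pair (prom (colDer C (withObj X.of A.of) ≫ proj₁ X.of A.of) ≫ g.of)
      (colDer C (withObj X.of A.of) ≫ proj₂ X.of A.of) := by
  have h : g ▷ A = lift (fst X A ≫ g) (snd X A) := by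
    ext <;> simp only [whiskerRight_fst, whiskerRight_snd, lift_fst, lift_snd]
  exact (congrArg Cokleisli.Hom.of h).trans
    (congrArg (fun k => FinScottL.pair k (snd X A).of) (kleisli_comp_of (fst X A) g))

theorem kleisliFix_natural (g : X ⟶ Z) (f : Z ⊗ A ⟶ A) :
    kleisliFix C X A (g ▷ A ≫ f) = g ≫ kleisliFix C Z A f := by
  have hcomp : (seely X.of A.of).hom ≫ (g ▷ A ≫ f).of =
      prom g.of ▷ colObj C A.of ≫ (seely Z.of A.of).hom ≫ f.of := by
    refine Eq.trans ?_ (seely_hom_prom_pair_proj g.of f.of)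
    exact congrArg ((seely X.of A.of).hom ≫ ·) ((kleisli_comp_of (g ▷ A) f).trans
      (congrArg (fun h => prom h ≫ f.of) (kleisli_whiskerRight_of g A)))
  refine Cokleisli.hom_ext _ ((congrArg (fixOp C X.of A.of) hcomp).trans ?_)
  exact (fixOp_natural g.of _).trans (kleisli_comp_of g (kleisliFix C Z A f)).symm

theorem kleisliFix_fixpoint (f : X ⊗ A ⟶ A) :
    kleisliFix C X A f = lift (𝟙 X) (kleisliFix C X A f) ≫ f :=
  Cokleisli.hom_ext _ ((fixOp_fixpoint _).trans ((con_prom_seely _ f.of).trans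
    (kleisli_comp_of (lift (𝟙 X) (kleisliFix C X A f)) f).symm))

theorem kleisliFix_lift_comp_of (f : X ⊗ B ⟶ A) (g : X ⊗ A ⟶ B) :
    (kleisliFix C X A (lift (fst X A) g ≫ f)).of =
      fixOp C X.of A.of (star ((seely X.of B.of).hom ≫ f.of) ((seely X.of A.of).hom ≫ g.of)) :=
  congrArg (fixOp C X.of A.of) (Eq.trans
    (congrArg ((seely X.of A.of).hom ≫ ·) (kleisli_comp_of (lift (fst X A) g) f))
    (seely_hom_prom_pair_star f.of g.of))

theorem kleisliFix_dinatural (f : X ⊗ B ⟶ A) (g : X ⊗ A ⟶ B) :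
    kleisliFix C X A (lift (fst X A) g ≫ f) =
      lift (𝟙 X) (kleisliFix C X B (lift (fst X B) f ≫ g)) ≫ f := by
  refine Cokleisli.hom_ext _ ((kleisliFix_lift_comp_of f g).trans ((fixOp_dinatural _ _).trans
    ((con_prom_seely _ f.of).trans (Eq.trans ?_ (kleisli_comp_of _ f).symm))))
  exact congrArg (fun h => prom (FinScottL.pair (colDer C X.of) h) ≫ f.of)
    (kleisliFix_lift_comp_of g f).symm

theorem kleisliFix_diagonal (f : (X ⊗ A) ⊗ A ⟶ A) :
    kleisliFix C X A (kleisliFix C (X ⊗ A) A f) =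
      kleisliFix C X A (lift (𝟙 (X ⊗ A)) (snd X A) ≫ f) := by
  have h := fixOp_diagonal
    ((seely X.of A.of).hom ▷ colObj C A.of ≫ (seely (withObj X.of A.of) A.of).hom ≫ f.of)
  rw [inv_hom_whiskerRight_assoc] at h
  refine Cokleisli.hom_ext _ (h.trans (congrArg (fixOp C X.of A.of) ?_))
  refine (seely_hom_prom_pair_diag f.of).symm.trans ?_
  exact congrArg ((seely X.of A.of).hom ≫ ·)
    (kleisli_comp_of (lift (𝟙 (X ⊗ A)) (snd X A)) f).symm

theorem isCartesianConwayOperator_kleisliFix (C : Finset ℕ) :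
    IsCartesianConwayOperator (kleisliFix.{u} C) where
  natural := kleisliFix_natural
  fixpoint := kleisliFix_fixpoint
  dinatural := kleisliFix_dinatural
  diagonal := kleisliFix_diagonal

end Kleisli

end FinScottL

/-! ### Soundness of the interpretation of the `λY`-calculus -/

namespace LambdaY

open CartesianMonoidalCategory

section CartesianClosed

variable {K : Type u} [Category.{v} K] [CartesianMonoidalCategory K] [MonoidalClosed K]
  {X Z A B : K}

theorem lift_curry_ev (s : X ⟶ A) (t : A ⊗ X ⟶ B) :
    lift s (MonoidalClosed.curry t) ≫ (ihom.ev A).app B = lift s (𝟙 X) ≫ t := by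
  have h : lift s (MonoidalClosed.curry t) = lift s (𝟙 X) ≫ A ◁ MonoidalClosed.curry t := by
    rw [lift_whiskerLeft, Category.id_comp]
  rw [h, Category.assoc, MonoidalClosed.whiskerLeft_curry_ihom_ev_app]

theorem comp_lift_ev (ρ : X ⟶ Z) (s : Z ⟶ A) (t : Z ⟶ (ihom A).obj B) :
    lift (ρ ≫ s) (ρ ≫ t) ≫ (ihom.ev A).app B = ρ ≫ lift s t ≫ (ihom.ev A).app B := by
  rw [← comp_lift, Category.assoc]

theorem curry_lift_ev (t : X ⟶ (ihom A).obj B) :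
    MonoidalClosed.curry (lift (fst A X) (snd A X ≫ t) ≫ (ihom.ev A).app B) = t := by
  have h : lift (fst A X) (snd A X ≫ t) = A ◁ t := by
    ext <;> simp only [lift_fst, lift_snd, whiskerLeft_fst, whiskerLeft_snd]
  rw [h, ← MonoidalClosed.uncurry_eq, MonoidalClosed.curry_uncurry]

end CartesianClosed

section Soundness

variable {K : Type u} [Category.{v} K] [CartesianMonoidalCategory K]

/-- An operator which turns endomorphisms in a context `X` into elements in this context is natural
when it commutes with changes of context. -/
def NaturalInParameter (Y : ∀ X A : K, (X ⊗ A ⟶ A) → (X ⟶ A)) : Prop :=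
  ∀ ⦃X Z A : K⦄ (g : X ⟶ Z) (f : Z ⊗ A ⟶ A), Y X A (g ▷ A ≫ f) = g ≫ Y Z A f

variable [MonoidalClosed K] {Y : ∀ X A : K, (X ⊗ A ⟶ A) → (X ⟶ A)}

theorem comp_fixSem (natural : NaturalInParameter Y) {X Z : K} (g : X ⟶ Z) (A : K) :
    g ≫ fixSem Y Z A = fixSem Y X A := by
  rw [fixSem, fixSem, ← MonoidalClosed.curry_natural_left, ← natural _ _, ← Category.assoc]
  congr 3
  ext <;> simp

theorem lift_fixSem_ev (natural : NaturalInParameter Y) {X A : K} (t : X ⟶ (ihom A).obj A) :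
    lift t (fixSem Y X A) ≫ (ihom.ev _).app A =
      Y X A (lift (snd X A) (fst X A ≫ t) ≫ (ihom.ev A).app A) := by
  rw [fixSem, lift_curry_ev, ← natural _ _, ← Category.assoc]
  congr 2
  ext <;> simp

theorem lift_fixSem_ev_unroll (natural : NaturalInParameter Y)
    (fixpoint : ∀ {X A : K} (f : X ⊗ A ⟶ A), Y X A f = lift (𝟙 X) (Y X A f) ≫ f)
    {X A : K} (t : X ⟶ (ihom A).obj A) :
    lift t (fixSem Y X A) ≫ (ihom.ev _).app A =
      lift (lift t (fixSem Y X A) ≫ (ihom.ev _).app A) t ≫ (ihom.ev A).app A := by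
  rw [lift_fixSem_ev natural]
  conv_lhs => rw [fixpoint]
  rw [← Category.assoc]
  congr 1
  ext <;> simp

variable {O : K} {S : Type w} {ty : S → Ty} {κ : ∀ c, 𝟙_ K ⟶ (ty c).sem O}
  {Γ Δ : List Ty} {σ τ : Ty} {ρ : ctxSem O Δ ⟶ ctxSem O Γ}

theorem sem_const_eq_comp (c : S) :
    (Tm.const c : Tm ty Δ (ty c)).sem Y O κ = ρ ≫ (Tm.const c : Tm ty Γ (ty c)).sem Y O κ := by
  simp only [Tm.sem, comp_toUnit_assoc]

theorem sem_lam_eq_comp {t : Tm ty (σ :: Γ) τ} {t' : Tm ty (σ :: Δ) τ}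
    (h : t'.sem Y O κ = (σ.sem O ◁ ρ) ≫ t.sem Y O κ) :
    (Tm.lam t').sem Y O κ = ρ ≫ (Tm.lam t).sem Y O κ :=
  (congrArg MonoidalClosed.curry h).trans (MonoidalClosed.curry_natural_left ρ (t.sem Y O κ))

theorem sem_app_eq_comp {t : Tm ty Γ (.arr σ τ)} {s : Tm ty Γ σ} {t' : Tm ty Δ (.arr σ τ)}
    {s' : Tm ty Δ σ} (ht : t'.sem Y O κ = ρ ≫ t.sem Y O κ) (hs : s'.sem Y O κ = ρ ≫ s.sem Y O κ) :
    (Tm.app t' s').sem Y O κ = ρ ≫ (Tm.app t s).sem Y O κ :=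
  (congrArg₂ (fun a b => lift a b ≫ (ihom.ev _).app _) hs ht).trans (comp_lift_ev ρ _ _)

theorem whiskerLeft_comp_sem_zero :
    (σ.sem O ◁ ρ) ≫ (Var.zero : Var (σ :: Γ) σ).sem O = (Var.zero : Var (σ :: Δ) σ).sem O :=
  whiskerLeft_fst _ _

theorem whiskerLeft_comp_sem_succ (x : Var Γ τ) :
    (σ.sem O ◁ ρ) ≫ (Var.succ x : Var (σ :: Γ) τ).sem O = snd _ _ ≫ ρ ≫ x.sem O :=
  whiskerLeft_snd_assoc _ _ _

theorem sem_ren (natural : NaturalInParameter Y) (t : Tm ty Γ τ) :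
    ∀ {Δ : List Ty} (r : ∀ τ, Var Γ τ → Var Δ τ) (ρ : ctxSem O Δ ⟶ ctxSem O Γ),
      (∀ τ x, (r τ x).sem O = ρ ≫ x.sem O) → (t.ren r).sem Y O κ = ρ ≫ t.sem Y O κ := by
  induction t with
  | var x => exact fun r ρ h => h _ x
  | const c => exact fun _ _ _ => sem_const_eq_comp c
  | lam t ih =>
    refine fun r ρ h => sem_lam_eq_comp (ih (liftRen r) (_ ◁ ρ) fun τ x => ?_)
    cases x with
    | zero => exact whiskerLeft_comp_sem_zero.symm
    | succ x => exact (congrArg (snd _ _ ≫ ·) (h τ x)).trans (whiskerLeft_comp_sem_succ x).symm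
  | app t s iht ihs => exact fun r ρ h => sem_app_eq_comp (iht r ρ h) (ihs r ρ h)
  | fix σ => exact fun _ ρ _ => (comp_fixSem natural ρ _).symm

theorem sem_wk (natural : NaturalInParameter Y) (t : Tm ty Γ τ) :
    (t.wk (σ := σ)).sem Y O κ = snd (σ.sem O) (ctxSem O Γ) ≫ t.sem Y O κ :=
  sem_ren natural t _ _ fun _ _ => rfl

theorem sem_sub (natural : NaturalInParameter Y) (t : Tm ty Γ τ) :
    ∀ {Δ : List Ty} (r : ∀ τ, Var Γ τ → Tm ty Δ τ) (ρ : ctxSem O Δ ⟶ ctxSem O Γ),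
      (∀ τ x, (r τ x).sem Y O κ = ρ ≫ x.sem O) → (t.sub r).sem Y O κ = ρ ≫ t.sem Y O κ := by
  induction t with
  | var x => exact fun r ρ h => h _ x
  | const c => exact fun _ _ _ => sem_const_eq_comp c
  | lam t ih =>
    refine fun r ρ h => sem_lam_eq_comp (ih (liftSub r) (_ ◁ ρ) fun τ x => ?_)
    cases x with
    | zero => exact whiskerLeft_comp_sem_zero.symm
    | succ x =>
      exact (sem_wk natural _).trans
        ((congrArg (snd _ _ ≫ ·) (h τ x)).trans (whiskerLeft_comp_sem_succ x).symm)
  | app t s iht ihs => exact fun r ρ h => sem_app_eq_comp (iht r ρ h) (ihs r ρ h)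
  | fix σ => exact fun _ ρ _ => (comp_fixSem natural ρ _).symm

theorem sem_single (s : Tm ty Γ σ) (τ : Ty) (x : Var (σ :: Γ) τ) :
    (single s τ x).sem Y O κ = lift (s.sem Y O κ) (𝟙 (ctxSem O Γ)) ≫ x.sem O := by
  cases x with
  | zero => exact (lift_fst _ _).symm
  | succ x => exact ((lift_snd_assoc _ _ _).trans (Category.id_comp _)).symm

theorem isModel_of_natural_of_fixpoint (natural : NaturalInParameter Y)
    (fixpoint : ∀ {X A : K} (f : X ⊗ A ⟶ A), Y X A f = lift (𝟙 X) (Y X A f) ≫ f) :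
    IsModel.{u, v, w} Y := by
  intro O S ty κ Γ τ t s h
  induction h with
  | refl t => rfl
  | symm _ ih => exact ih.symm
  | trans _ _ ih ih' => exact ih.trans ih'
  | lam _ ih => exact congrArg MonoidalClosed.curry ih
  | app _ _ ih ih' => exact congrArg₂ (fun a b => lift a b ≫ (ihom.ev _).app _) ih' ih
  | beta t s =>
    rw [sem_sub natural t _ _ (sem_single s)]
    exact lift_curry_ev _ _
  | eta t =>
    exact (congrArg (fun a => MonoidalClosed.curry (lift (fst _ _) a ≫ (ihom.ev _).app _))
      (sem_wk natural t)).trans (curry_lift_ev _)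
  | delta t => exact lift_fixSem_ev_unroll natural fixpoint _

end Soundness

end LambdaY

theorem mainTheorem5 (C : Finset ℕ) :
    FinScottL.IsConwayOperator.{u} C (FinScottL.fixOp C) ∧
      IsCartesianConwayOperator (FinScottL.kleisliFix.{u} C) ∧
      LambdaY.IsModel.{u + 1, u, w} (FinScottL.kleisliFix.{u} C) :=
  ⟨FinScottL.isConwayOperator_fixOp C, FinScottL.isCartesianConwayOperator_kleisliFix C,
    LambdaY.isModel_of_natural_of_fixpoint (fun _ _ _ => FinScottL.kleisliFix_natural)
      FinScottL.kleisliFix_fixpoint⟩
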